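/- Let $(\Omega,\mathcal F,P)$ be a probability space, let $L^0(\mathcal F)$ be the algebra of equivalence classes of real-valued $\mathcal F$-measurable random variables, and let $\bar L^0(\mathcal F)$ be the complete lattice of equivalence classes of extended real-valued $\mathcal F$-measurable random variables, both ordered by $\xi\le\eta$ iff $\xi\le\eta$ almost surely; $\bigvee$ denotes the supremum in $\bar L^0(\mathcal F)$. Let $(E,\mathcal P)$ be a random locally convex (RLC) module over $\mathbb R$ with base $(\Omega,\mathcal F,P)$: $E$ is an $L^0(\mathcal F)$-module and $\mathcal P$ is a family of maps $\|\cdot\|\colon E\to L^0_+(\mathcal F)$ with $\|\xi x\|=|\xi|\,\|x\|$ and $\|x+y\|\le\|x\|+\|y\|$ for all $\xi\in L^0(\mathcal F)$, $x,y\in E$, such that $\bigvee\{\|x\|:\|\cdot\|\in\mathcal P\}=0$ (that is, $\|x\|=0$ for all $\|\cdot\|\in\mathcal P$) iff $x=0$. The $(\varepsilon,\lambda)$-topology $\mathcal T_{\varepsilon,\lambda}$ on $E$ is the linear topology with local base at $0$ consisting of the sets $$\{x\in E: P(\{\omega:\|x\|_{\mathcal Q}(\omega)<\varepsilon\})>1-\lambda\},\qquad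 \mathcal Q\subset\mathcal P\text{ finite},\ \varepsilon>0,\ 0<\lambda<1,$$ where $\|x\|_{\mathcal Q}=\max\{\|x\|:\|\cdot\|\in\mathcal Q\}$ (and $\|x\|_\emptyset=0$). The space $L^0(\mathcal F)$ carries the $(\varepsilon,\lambda)$-topology given by the single $L^0$-norm $|\cdot|$. Let $E^*_{\varepsilon,\lambda}$ be the set of all continuous $L^0(\mathcal F)$-module homomorphisms from $(E,\mathcal T_{\varepsilon,\lambda})$ to $(L^0(\mathcal F),\mathcal T_{\varepsilon,\lambda})$. Let $f\colon E\to\bar L^0(\mathcal F)$ be * proper: $f(x)>-\infty$ a.s. for every $x\in E$, and there is $x\in E$ with $|f(x)|<+\infty$ a.s.; * $L^0$-convex: $f(\xi x+(1-\xi)y)\le\xi f(x)+(1-\xi)f(y)$ for all $x,y\in E$ and all $\xi\in L^0(\mathcal F)$ with $0\le\xi\le1$, with the conventions $0\cdot(\pm\infty)=0$ and $+\infty\pm(\pm\infty)=+\infty$; * $\mathcal T_{\varepsilon,\lambda}$-lower semicontinuous: its epigraph $\{(x,r)\in E\times L^0(\mathcal F): f(x)\le r\}$ is closed in $(E,\mathcal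 T_{\varepsilon,\lambda})\times(L^0(\mathcal F),\mathcal T_{\varepsilon,\lambda})$. Define $f^*_{\varepsilon,\lambda}\colon E^*_{\varepsilon,\lambda}\to\bar L^0(\mathcal F)$ and $f^{**}_{\varepsilon,\lambda}\colon E\to\bar L^0(\mathcal F)$ by $$f^*_{\varepsilon,\lambda}(g)=\bigvee\{g(x)-f(x):x\in E\},\qquad f^{**}_{\varepsilon,\lambda}(x)=\bigvee\{g(x)-f^*_{\varepsilon,\lambda}(g):g\in E^*_{\varepsilon,\lambda}\}.$$ Then $f^{**}_{\varepsilon,\lambda}=f$. -/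

import Mathlib

open MeasureTheory Filter Topology

noncomputable section

/-- `L⁰(𝓕)`: equivalence classes of real-valued random variables, with the a.s. order. -/
abbrev L0 {Ω : Type*} [MeasurableSpace Ω] (μ : Measure Ω) : Type _ := Ω →ₘ[μ] ℝ

/-- `L̄⁰(𝓕)`: equivalence classes of extended real-valued random variables, with the a.s. order. -/
abbrev L0bar {Ω : Type*} [MeasurableSpace Ω] (μ : Measure Ω) : Type _ := Ω →ₘ[μ] EReal

/-- The (pointwise a.s.) ring structure of `L⁰(𝓕)`, on top of Mathlib's addition and
multiplication of classes of functions. -/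
instance L0.instCommRing {Ω : Type*} [MeasurableSpace Ω] (μ : Measure Ω) : CommRing (L0 μ) :=
  { (inferInstance : AddCommGroup (L0 μ)), (inferInstance : CommMonoid (L0 μ)) with
    left_distrib := fun a b c => by
      refine AEEqFun.ext ?_
      filter_upwards [AEEqFun.coeFn_mul a (b + c), AEEqFun.coeFn_add b c,
        AEEqFun.coeFn_add (a * b) (a * c), AEEqFun.coeFn_mul a b, AEEqFun.coeFn_mul a c]
        with ω h1 h2 h3 h4 h5
      simp only [Pi.mul_apply, Pi.add_apply] at h1 h2 h3 h4 h5
      rw [h1, h2, h3, h4, h5, mul_add]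
    right_distrib := fun a b c => by
      refine AEEqFun.ext ?_
      filter_upwards [AEEqFun.coeFn_mul (a + b) c, AEEqFun.coeFn_add a b,
        AEEqFun.coeFn_add (a * c) (b * c), AEEqFun.coeFn_mul a c, AEEqFun.coeFn_mul b c]
        with ω h1 h2 h3 h4 h5
      simp only [Pi.mul_apply, Pi.add_apply] at h1 h2 h3 h4 h5
      rw [h1, h2, h3, h4, h5, add_mul]
    zero_mul := fun a => by
      refine AEEqFun.ext ?_
      filter_upwards [AEEqFun.coeFn_mul 0 a, AEEqFun.coeFn_zero (μ := μ) (β := ℝ)] with ω h1 h2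
      simp only [Pi.mul_apply, Pi.zero_apply] at h1 h2
      rw [h1, h2, zero_mul]
    mul_zero := fun a => by
      refine AEEqFun.ext ?_
      filter_upwards [AEEqFun.coeFn_mul a 0, AEEqFun.coeFn_zero (μ := μ) (β := ℝ)] with ω h1 h2
      simp only [Pi.mul_apply, Pi.zero_apply] at h1 h2
      rw [h1, h2, mul_zero] }

/-- The inclusion `L⁰(𝓕) ⊆ L̄⁰(𝓕)`. -/
def L0.toBar {Ω : Type*} [MeasurableSpace Ω] {μ : Measure Ω} (ξ : L0 μ) : L0bar μ :=
  AEEqFun.comp (fun a : ℝ => (a : EReal)) continuous_coe_real_ereal ξ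

theorem measurable_real_sub_ereal :
    Measurable (Function.uncurry fun (a : ℝ) (b : EReal) => (a : EReal) - b) := by
  have h1 : Measurable fun p : ℝ × EReal => (p.1 : EReal) :=
    measurable_coe_real_ereal.comp measurable_fst
  have h2 : Measurable fun p : ℝ × EReal => -p.2 :=
    continuous_neg.measurable.comp measurable_snd
  exact h1.add h2

/-- The difference `ξ - η` for `ξ ∈ L⁰(𝓕)` and `η ∈ L̄⁰(𝓕)`; it is unambiguous, as `ξ` is finite. -/
def L0.subBar {Ω : Type*} [MeasurableSpace Ω] {μ : Measure Ω} (ξ : L0 μ) (η : L0bar μ) :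
    L0bar μ :=
  AEEqFun.comp₂Measurable (fun (a : ℝ) (b : EReal) => (a : EReal) - b)
    measurable_real_sub_ereal ξ η

/-- Every subset of `L̄⁰(𝓕)` has a least upper bound for the a.s. order. -/
theorem L0bar.exists_isLUB {Ω : Type*} [MeasurableSpace Ω] {μ : Measure Ω} [IsFiniteMeasure μ]
    (S : Set (L0bar μ)) : ∃ η : L0bar μ, IsLUB S η := by
  classical
  -- without loss of generality the class of `⊥` belongs to the set
  let b : L0bar μ := AEEqFun.const Ω ⊥
  have hb : ∀ η : L0bar μ, b ≤ η := by
    intro η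
    rw [← AEEqFun.coeFn_le]
    filter_upwards [AEEqFun.coeFn_const (μ := μ) Ω (⊥ : EReal)] with ω h
    rw [h]
    exact bot_le
  suffices H : ∃ η : L0bar μ, IsLUB (insert b S) η by
    obtain ⟨η, h1, h2⟩ := H
    refine ⟨η, fun s hs => h1 (Set.mem_insert_of_mem _ hs), fun c hc => h2 ?_⟩
    rintro s (rfl | hs)
    · exact hb c
    · exact hc hs
  set T := insert b S with hT
  -- `φ` is a strictly decreasing bounded function on the extended reals
  let φ : EReal → ENNReal := fun x => (1 + EReal.exp x)⁻¹
  have hφ : StrictAnti φ := by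
    intro x y hxy
    refine ENNReal.inv_lt_inv.2 ?_
    exact ENNReal.add_lt_add_left ENNReal.one_ne_top (EReal.exp_strictMono hxy)
  have hφ1 : ∀ x, φ x ≤ 1 := fun x => by
    refine ENNReal.inv_le_one.2 ?_
    exact le_self_add
  have hφm : Measurable φ := hφ.antitone.measurable
  -- countable suprema
  have hms : ∀ u : ℕ → L0bar μ, AEStronglyMeasurable (fun ω => ⨆ n, u n ω) μ := fun u =>
    (AEMeasurable.iSup fun n => (u n).aestronglyMeasurable.aemeasurable).aestronglyMeasurable
  let I : (ℕ → T) → ENNReal := fun u => ∫⁻ ω, φ (⨆ n, (u n).1 ω) ∂μ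
  obtain ⟨J, -, hJ, hJm⟩ := exists_seq_tendsto_sInf
    (S := Set.range I) (Set.range_nonempty_iff_nonempty.2 ⟨fun _ => ⟨b, Set.mem_insert _ _⟩⟩)
    (OrderBot.bddBelow _)
  choose U hU using hJm
  let V : ℕ → T := fun k => U k.unpair.1 k.unpair.2
  have hVle : ∀ (W : ℕ → T) (u : ℕ → T), (∀ n, ∃ k, W k = u n) → I W ≤ I u := by
    intro W u h
    refine lintegral_mono fun ω => hφ.antitone (iSup_le fun n => ?_)
    obtain ⟨k, hk⟩ := h n
    rw [← hk]
    exact le_iSup (f := fun k => (W k).1 ω) k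
  have hV : I V ≤ sInf (Set.range I) := by
    refine ge_of_tendsto' hJ fun n => ?_
    rw [← hU n]
    refine hVle _ _ fun m => ⟨Nat.pair n m, ?_⟩
    simp [V, Nat.unpair_pair]
  refine ⟨AEEqFun.mk _ (hms fun n => (V n).1), fun g hg => ?_, fun c hc => ?_⟩
  · let W : ℕ → T := fun n => Nat.casesOn n ⟨g, hg⟩ V
    have h1 : I V ≤ I W := hV.trans (sInf_le ⟨W, rfl⟩)
    have h2 : ∀ ω, φ (⨆ n, (W n).1 ω) ≤ φ (⨆ n, (V n).1 ω) := fun ω =>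
      hφ.antitone (iSup_le fun n => by
        have h := le_iSup (f := fun k => (W k).1 ω) (n + 1)
        exact h)
    have hfin : I W ≠ ⊤ := by
      refine ne_top_of_le_ne_top (measure_ne_top μ Set.univ) ?_
      calc I W ≤ ∫⁻ _, 1 ∂μ := lintegral_mono fun ω => hφ1 _
        _ = μ Set.univ := by simp
    have h3 := ae_eq_of_ae_le_of_lintegral_le (Eventually.of_forall h2) hfin
      (hφm.comp_aemeasurable (hms fun n => (V n).1).aemeasurable) h1
    rw [← AEEqFun.coeFn_le]
    filter_upwards [h3, AEEqFun.coeFn_mk _ (hms fun n => (V n).1)] with ω h4 h5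
    rw [h5, ← hφ.injective h4]
    exact le_iSup (f := fun k => (W k).1 ω) 0
  · rw [← AEEqFun.coeFn_le]
    have h1 : ∀ n, (V n : L0bar μ) ≤ᵐ[μ] c := fun n => AEEqFun.coeFn_le.2 (hc (V n).2)
    filter_upwards [ae_all_iff.2 h1, AEEqFun.coeFn_mk _ (hms fun n => (V n).1)] with ω h2 h3
    rw [h3]
    exact iSup_le h2

/-- The supremum `⋁ S` of a subset of the complete lattice `L̄⁰(𝓕)`. -/
def L0bar.sup {Ω : Type*} [MeasurableSpace Ω] {μ : Measure Ω} [IsFiniteMeasure μ]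
    (S : Set (L0bar μ)) : L0bar μ :=
  Classical.choose (L0bar.exists_isLUB S)

theorem L0bar.isLUB_sup {Ω : Type*} [MeasurableSpace Ω] {μ : Measure Ω} [IsFiniteMeasure μ]
    (S : Set (L0bar μ)) : IsLUB S (L0bar.sup S) :=
  Classical.choose_spec (L0bar.exists_isLUB S)

/-- `p : E → L⁰₊(𝓕)` is an `L⁰`-seminorm on the `L⁰(𝓕)`-module `E`. -/
structure IsL0Seminorm {Ω : Type*} [MeasurableSpace Ω] {μ : Measure Ω} {E : Type*}
    [AddCommGroup E] [Module (L0 μ) E] (p : E → L0 μ) : Prop where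
  nonneg : ∀ x, 0 ≤ p x
  smul : ∀ (ξ : L0 μ) (x : E), p (ξ • x) = |ξ| * p x
  add_le : ∀ x y, p (x + y) ≤ p x + p y

/-- `(E, P)` is a random locally convex module over `ℝ` with base `(Ω, 𝓕, μ)`: `P` is a family of
`L⁰`-seminorms with `⋁ {‖x‖ : ‖·‖ ∈ P} = 0` iff `x = 0` (the supremum of a family of nonnegative
elements vanishes iff all of them do). -/
structure IsRLCModule {Ω : Type*} [MeasurableSpace Ω] {μ : Measure Ω} {E : Type*}
    [AddCommGroup E] [Module (L0 μ) E] (P : Set (E → L0 μ)) : Prop where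
  seminorm : ∀ p ∈ P, IsL0Seminorm p
  separating : ∀ x : E, (∀ p ∈ P, p x = 0) ↔ x = 0

/-- `N(Q, ε, lam) = {x : μ{ω : ‖x‖_Q(ω) < ε} > 1 - lam}`, where `‖x‖_Q` is the maximum of the
`‖x‖`, `‖·‖ ∈ Q`, for a finite set `Q` of `L⁰`-seminorms. -/
def epsLamBall {Ω : Type*} [MeasurableSpace Ω] {μ : Measure Ω} {E : Type*}
    (Q : Set (E → L0 μ)) (ε lam : ℝ) : Set E :=
  {x | 1 - lam < μ.real {ω | ∀ p ∈ Q, p x ω < ε}}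

theorem epsLamBall_mono {Ω : Type*} [MeasurableSpace Ω] {μ : Measure Ω} [IsFiniteMeasure μ]
    {E : Type*} {Q Q' : Set (E → L0 μ)} (h : Q ⊆ Q') {ε ε' lam lam' : ℝ} (hε : ε' ≤ ε)
    (hl : lam' ≤ lam) : epsLamBall Q' ε' lam' ⊆ epsLamBall Q ε lam := by
  intro x hx
  have h1 : 1 - lam' < μ.real {ω | ∀ p ∈ Q', p x ω < ε'} := hx
  have h2 : μ.real {ω | ∀ p ∈ Q', p x ω < ε'} ≤ μ.real {ω | ∀ p ∈ Q, p x ω < ε} :=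
    measureReal_mono fun ω hω p hp => (hω p (h hp)).trans_le hε
  change 1 - lam < μ.real {ω | ∀ p ∈ Q, p x ω < ε}
  linarith

/-- The `(ε, λ)`-topology induced by `P`: a set is open iff it contains, with each of its points
`x`, some `x + N(Q, ε, lam)` with `Q ⊆ P` finite, `ε > 0` and `0 < lam < 1`. -/
@[reducible] def epsLamTopology {Ω : Type*} [MeasurableSpace Ω] {μ : Measure Ω} [IsFiniteMeasure μ]
    {E : Type*} [AddCommGroup E] (P : Set (E → L0 μ)) : TopologicalSpace E where
  IsOpen U := ∀ x ∈ U, ∃ Q : Set (E → L0 μ), Q ⊆ P ∧ Q.Finite ∧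
    ∃ ε lam : ℝ, 0 < ε ∧ 0 < lam ∧ lam < 1 ∧ ∀ y, y - x ∈ epsLamBall Q ε lam → y ∈ U
  isOpen_univ := fun x _ => ⟨∅, Set.empty_subset _, Set.finite_empty, 1, 1 / 2, by norm_num,
    by norm_num, by norm_num, fun y _ => Set.mem_univ y⟩
  isOpen_inter := by
    rintro U V hU hV x ⟨hxU, hxV⟩
    obtain ⟨Q, hQ, hQf, ε, l, hε, hl, hl1, h⟩ := hU x hxU
    obtain ⟨Q', hQ', hQf', ε', l', hε', hl', hl1', h'⟩ := hV x hxV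
    refine ⟨Q ∪ Q', Set.union_subset hQ hQ', hQf.union hQf', min ε ε', min l l',
      lt_min hε hε', lt_min hl hl', (min_le_left _ _).trans_lt hl1, fun y hy => ⟨?_, ?_⟩⟩
    · exact h y (epsLamBall_mono Set.subset_union_left (min_le_left _ _) (min_le_left _ _) hy)
    · exact h' y (epsLamBall_mono Set.subset_union_right (min_le_right _ _) (min_le_right _ _) hy)
  isOpen_sUnion := by
    rintro s hs x ⟨U, hU, hx⟩
    obtain ⟨Q, hQ, hQf, ε, l, hε, hl, hl1, h⟩ := hs U hU x hx
    exact ⟨Q, hQ, hQf, ε, l, hε, hl, hl1, fun y hy => ⟨U, hU, h y hy⟩⟩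

/-- The `(ε, λ)`-topology of `L⁰(𝓕)`, induced by the single `L⁰`-norm `|·|`. -/
@[reducible] def L0EpsLamTopology {Ω : Type*} [MeasurableSpace Ω] (μ : Measure Ω) [IsFiniteMeasure μ] :
    TopologicalSpace (L0 μ) :=
  epsLamTopology {fun ξ : L0 μ => |ξ|}

/-- The random conjugate space `E*_{ε,λ}`: the continuous module homomorphisms from `E` to
`L⁰(𝓕)`, both with their `(ε, λ)`-topology. -/
def EpsLamDual {Ω : Type*} [MeasurableSpace Ω] {μ : Measure Ω} [IsFiniteMeasure μ] {E : Type*}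
    [AddCommGroup E] [Module (L0 μ) E] (P : Set (E → L0 μ)) : Type _ :=
  {g : E →ₗ[L0 μ] L0 μ // Continuous[epsLamTopology P, L0EpsLamTopology μ] g}

/-- Addition of extended reals with the convention `+∞ + (-∞) = (-∞) + (+∞) = +∞`. -/
def addTop (a b : EReal) : EReal := if a = ⊤ ∨ b = ⊤ then ⊤ else a + b

/-- `f : E → L̄⁰(𝓕)` is `L⁰(𝓕)`-convex: `f (ξ x + (1 - ξ) y) ≤ ξ f(x) + (1 - ξ) f(y)` a.s. whenever
`0 ≤ ξ ≤ 1`, with the conventions `0 · (±∞) = 0` and `+∞ + (-∞) = +∞`. -/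
def IsL0Convex {Ω : Type*} [MeasurableSpace Ω] {μ : Measure Ω} {E : Type*}
    [AddCommGroup E] [Module (L0 μ) E] (f : E → L0bar μ) : Prop :=
  ∀ (x y : E) (ξ : L0 μ), 0 ≤ ξ → ξ ≤ 1 →
    ∀ᵐ ω ∂μ, f (ξ • x + (1 - ξ) • y) ω ≤
      addTop ((ξ ω : EReal) * f x ω) (((1 - ξ ω : ℝ) : EReal) * f y ω)

/-- The effective domain of `f`. -/
def L0Dom {Ω : Type*} [MeasurableSpace Ω] {μ : Measure Ω} {E : Type*} (f : E → L0bar μ) : Set E :=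
  {x | ∀ᵐ ω ∂μ, ⊥ < f x ω ∧ f x ω < ⊤}

/-- `f` is proper: its effective domain is non-empty and `f(x) > -∞` a.s. for every `x`. -/
def IsL0Proper {Ω : Type*} [MeasurableSpace Ω] {μ : Measure Ω} {E : Type*}
    (f : E → L0bar μ) : Prop :=
  (L0Dom f).Nonempty ∧ ∀ x, ∀ᵐ ω ∂μ, ⊥ < f x ω

/-- The epigraph of `f`, a subset of `E × L⁰(𝓕)`. -/
def L0Epi {Ω : Type*} [MeasurableSpace Ω] {μ : Measure Ω} {E : Type*} (f : E → L0bar μ) :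
    Set (E × L0 μ) :=
  {z | f z.1 ≤ z.2.toBar}

/-- `f` is `(ε, λ)`-lower semicontinuous: its epigraph is closed in the product of the
`(ε, λ)`-topologies of `E` and `L⁰(𝓕)`. -/
def IsEpsLamLSC {Ω : Type*} [MeasurableSpace Ω] {μ : Measure Ω} [IsFiniteMeasure μ] {E : Type*}
    [AddCommGroup E] (P : Set (E → L0 μ)) (f : E → L0bar μ) : Prop :=
  IsClosed[@instTopologicalSpaceProd E (L0 μ) (epsLamTopology P) (L0EpsLamTopology μ)] (L0Epi f)

/-- The conjugate `f*(g) = ⋁ {g(x) - f(x) : x ∈ E}`, for `g ∈ E*_{ε,λ}`. -/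
def epsLamConj {Ω : Type*} [MeasurableSpace Ω] {μ : Measure Ω} [IsFiniteMeasure μ] {E : Type*}
    [AddCommGroup E] [Module (L0 μ) E] (P : Set (E → L0 μ)) (f : E → L0bar μ)
    (g : EpsLamDual P) : L0bar μ :=
  L0bar.sup (Set.range fun x : E => (g.1 x).subBar (f x))

/-- The biconjugate `f**(x) = ⋁ {g(x) - f*(g) : g ∈ E*_{ε,λ}}`, for `x ∈ E`. -/
def epsLamBiconj {Ω : Type*} [MeasurableSpace Ω] {μ : Measure Ω} [IsFiniteMeasure μ] {E : Type*}
    [AddCommGroup E] [Module (L0 μ) E] (P : Set (E → L0 μ)) (f : E → L0bar μ) (x : E) : L0bar μ :=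
  L0bar.sup (Set.range fun g : EpsLamDual P => (g.1 x).subBar (epsLamConj P f g))

end

/-! The inequality `f** ≤ f` is Young-Fenchel. For the converse, suppose `f**(x₀) < q < f(x₀)` on a
non-negligible set `B`, with `q` rational. It suffices to find a non-negligible `A ⊆ B` and a
continuous module homomorphism `g` with `q + g(x - x₀) ≤ f(x)` on `A` for every `x`: then `f*(g) ≤
g(x₀) - q` on `A`, so `f**(x₀) ≥ q` there, a contradiction (`le_epsLamBiconj`).

Such a `g` comes from separating `(x₀, q)` from the epigraph. The `(ε, λ)`-topology need not be
locally convex, so separation rests on a Hahn-Banach theorem with values in `L⁰`, where bounded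
infima exist. Closedness only says that each point of the epigraph is, with probability at least
some `lam`, at random distance at least `ε` from the excluded point. By convexity these distances
form a downward directed family, and so a single set of measure at least `lam` serves for all points
(`exists_set_le_of_directed`). The sandwich form of Hahn-Banach (`exists_linear_le_of_convex`) then
gives a functional that is at least `ε` on that set (`exists_functional_of_notMem_epi`).

The separating hyperplane may be vertical at some `ω`. A second separation, below a point of the
graph over the effective domain, is nowhere vertical on its set; adding a large random multiple of
the first to it gives the affine minorant (`exists_minorant_epi`). -/

noncomputable section

/-! ### The ordered ring `L⁰`: pointwise rules, infima, division -/

namespace L0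

variable {Ω : Type*} [MeasurableSpace Ω] {μ : Measure Ω}

theorem le_iff {a b : L0 μ} : a ≤ b ↔ ∀ᵐ ω ∂μ, a ω ≤ b ω := AEEqFun.coeFn_le.symm

theorem ext_iff {a b : L0 μ} : a = b ↔ ∀ᵐ ω ∂μ, a ω = b ω := AEEqFun.ext_iff

theorem add_apply (a b : L0 μ) : ∀ᵐ ω ∂μ, (a + b) ω = a ω + b ω := AEEqFun.coeFn_add a b

theorem sub_apply (a b : L0 μ) : ∀ᵐ ω ∂μ, (a - b) ω = a ω - b ω := AEEqFun.coeFn_sub a b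

theorem neg_apply (a : L0 μ) : ∀ᵐ ω ∂μ, (-a) ω = -a ω := AEEqFun.coeFn_neg a

theorem mul_apply (a b : L0 μ) : ∀ᵐ ω ∂μ, (a * b) ω = a ω * b ω := AEEqFun.coeFn_mul a b

theorem zero_apply : ∀ᵐ ω ∂μ, (0 : L0 μ) ω = 0 := AEEqFun.coeFn_zero

theorem one_apply : ∀ᵐ ω ∂μ, (1 : L0 μ) ω = 1 := AEEqFun.coeFn_one

theorem abs_apply (a : L0 μ) : ∀ᵐ ω ∂μ, |a| ω = |a ω| := AEEqFun.coeFn_abs a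

theorem abs_mul (a b : L0 μ) : |a * b| = |a| * |b| := by
  rw [ext_iff]
  filter_upwards [abs_apply (a * b), mul_apply a b, mul_apply |a| |b|, abs_apply a, abs_apply b]
    with ω e1 e2 e3 e4 e5
  rw [e1, e2, e3, e4, e5, _root_.abs_mul]

theorem toBar_apply (a : L0 μ) : ∀ᵐ ω ∂μ, a.toBar ω = (a ω : EReal) :=
  AEEqFun.coeFn_comp _ _ a

theorem subBar_apply (a : L0 μ) (b : L0bar μ) :
    ∀ᵐ ω ∂μ, a.subBar b ω = (a ω : EReal) - b ω :=
  AEEqFun.coeFn_comp₂Measurable _ _ a b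

instance instIsOrderedAddMonoid : IsOrderedAddMonoid (L0 μ) where
  add_le_add_left a b h c := by
    rw [le_iff] at h ⊢
    filter_upwards [h, add_apply a c, add_apply b c] with ω h h1 h2
    rw [h1, h2]
    gcongr

instance instIsOrderedRing : IsOrderedRing (L0 μ) where
  zero_le_one := by
    rw [le_iff]
    filter_upwards [zero_apply (μ := μ), one_apply (μ := μ)] with ω h h1
    rw [h, h1]
    norm_num
  mul_le_mul_of_nonneg_left a ha b c h := by
    simp only [le_iff] at *
    filter_upwards [h, ha, mul_apply a b, mul_apply a c, zero_apply (μ := μ)] with ω h ha h1 h2 h3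
    rw [h1, h2]
    exact mul_le_mul_of_nonneg_left h (h3 ▸ ha)
  mul_le_mul_of_nonneg_right a ha b c h := by
    simp only [le_iff] at *
    filter_upwards [h, ha, mul_apply b a, mul_apply c a, zero_apply (μ := μ)] with ω h ha h1 h2 h3
    rw [h1, h2]
    exact mul_le_mul_of_nonneg_right h (h3 ▸ ha)

/-- The class of a measurable function. -/
def of (φ : Ω → ℝ) (h : Measurable φ) : L0 μ := AEEqFun.mk φ h.aestronglyMeasurable

theorem of_apply (φ : Ω → ℝ) (h : Measurable φ) : ∀ᵐ ω ∂μ, (of φ h : L0 μ) ω = φ ω :=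
  AEEqFun.coeFn_mk _ _

/-- The class of a constant function. -/
def const (c : ℝ) : L0 μ := of (fun _ => c) measurable_const

theorem const_apply (c : ℝ) : ∀ᵐ ω ∂μ, (const c : L0 μ) ω = c := of_apply _ _

/-- The pointwise inverse, with the convention `0⁻¹ = 0`. -/
def inv (a : L0 μ) : L0 μ := AEEqFun.compMeasurable (fun x : ℝ => x⁻¹) measurable_inv a

theorem inv_apply (a : L0 μ) : ∀ᵐ ω ∂μ, a.inv ω = (a ω)⁻¹ := AEEqFun.coeFn_compMeasurable _ _ a

/-- The indicator of a measurable set. -/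
def ind (A : Set Ω) (hA : MeasurableSet A) : L0 μ :=
  of (A.indicator fun _ => 1) (measurable_const.indicator hA)

theorem ind_apply {A : Set Ω} (hA : MeasurableSet A) :
    ∀ᵐ ω ∂μ, (ω ∈ A → (ind A hA : L0 μ) ω = 1) ∧ (ω ∉ A → (ind A hA : L0 μ) ω = 0) := by
  filter_upwards [of_apply (μ := μ) (A.indicator fun _ => (1 : ℝ))
    (measurable_const.indicator hA)] with ω h
  rw [ind, h]
  exact ⟨fun h => Set.indicator_of_mem h _, fun h => Set.indicator_of_notMem h _⟩

theorem ind_nonneg {A : Set Ω} (hA : MeasurableSet A) : 0 ≤ (ind A hA : L0 μ) := by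
  rw [le_iff]
  filter_upwards [ind_apply (μ := μ) hA, zero_apply (μ := μ)] with ω h h0
  by_cases hω : ω ∈ A
  · rw [h.1 hω, h0]; norm_num
  · rw [h.2 hω, h0]

theorem ind_le_one {A : Set Ω} (hA : MeasurableSet A) : (ind A hA : L0 μ) ≤ 1 := by
  rw [le_iff]
  filter_upwards [ind_apply (μ := μ) hA, one_apply (μ := μ)] with ω h h0
  by_cases hω : ω ∈ A
  · rw [h.1 hω, h0]
  · rw [h.2 hω, h0]; norm_num

theorem ind_compl {A : Set Ω} (hA : MeasurableSet A) :
    (ind Aᶜ hA.compl : L0 μ) = 1 - ind A hA := by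
  rw [ext_iff]
  filter_upwards [ind_apply (μ := μ) hA, ind_apply (μ := μ) hA.compl, one_apply (μ := μ),
    sub_apply (μ := μ) 1 (ind A hA)] with ω h h' h1 h2
  rw [h2, h1]
  by_cases hω : ω ∈ A
  · rw [h.1 hω, h'.2 (not_not.2 hω)]; norm_num
  · rw [h.2 hω, h'.1 hω]; norm_num

theorem ind_mul_self {A : Set Ω} (hA : MeasurableSet A) :
    (ind A hA : L0 μ) * ind A hA = ind A hA := by
  rw [ext_iff]
  filter_upwards [ind_apply (μ := μ) hA, mul_apply (μ := μ) (ind A hA) (ind A hA)] with ω h h2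
  rw [h2]
  by_cases hω : ω ∈ A
  · rw [h.1 hω]; norm_num
  · rw [h.2 hω]; norm_num

/-- Every non-empty bounded below subset of `L⁰(𝓕)` has a greatest lower bound. -/
theorem exists_isGLB [IsFiniteMeasure μ] {S : Set (L0 μ)} (hS : S.Nonempty) (hb : BddBelow S) :
    ∃ a, IsGLB S a := by
  obtain ⟨l, hl⟩ := hb
  obtain ⟨s₀, hs₀⟩ := hS
  -- The infimum is minus a supremum in `L̄⁰`. It is real-valued because the supremum lies between
  -- `-s₀` and `-l`.
  obtain ⟨η, h1, h2⟩ := L0bar.exists_isLUB ((fun s : L0 μ => (-s).toBar) '' S)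
  have key : ∀ c : L0 μ, (-c).toBar ≤ η ↔ ∀ᵐ ω ∂μ, ((-(c ω) : ℝ) : EReal) ≤ η ω := by
    intro c
    rw [← AEEqFun.coeFn_le]
    refine eventually_congr ?_
    filter_upwards [toBar_apply (-c), neg_apply c] with ω h h'
    rw [h, h']
  have key' : ∀ c : L0 μ, η ≤ (-c).toBar ↔ ∀ᵐ ω ∂μ, η ω ≤ ((-(c ω) : ℝ) : EReal) := by
    intro c
    rw [← AEEqFun.coeFn_le]
    refine eventually_congr ?_
    filter_upwards [toBar_apply (-c), neg_apply c] with ω h h'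
    rw [h, h']
  have hub : ∀ c ∈ lowerBounds S, η ≤ (-c).toBar := by
    intro c hc
    refine h2 ?_
    rintro _ ⟨s, hs, rfl⟩
    rw [← AEEqFun.coeFn_le]
    filter_upwards [toBar_apply (-c), toBar_apply (-s), neg_apply c, neg_apply s,
      le_iff.1 (hc hs)] with ω e1 e2 e3 e4 h
    rw [e1, e2, e3, e4]
    exact_mod_cast neg_le_neg h
  have hlow := (key s₀).1 (h1 ⟨s₀, hs₀, rfl⟩)
  have hup := (key' l).1 (hub l hl)
  let a : L0 μ := AEEqFun.compMeasurable (fun x : EReal => -x.toReal)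
    (measurable_ereal_toReal.neg) η
  have ha : ∀ᵐ ω ∂μ, η ω = ((-(a ω) : ℝ) : EReal) := by
    filter_upwards [hlow, hup, AEEqFun.coeFn_compMeasurable (fun x : EReal => -x.toReal)
      (measurable_ereal_toReal.neg) η] with ω e1 e2 e3
    rw [e3]
    simp only [Function.comp, neg_neg]
    refine (EReal.coe_toReal ?_ ?_).symm
    · exact (e2.trans_lt (EReal.coe_lt_top _)).ne
    · exact ((EReal.bot_lt_coe _).trans_le e1).ne'
  refine ⟨a, fun s hs => ?_, fun c hc => ?_⟩
  · rw [le_iff]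
    filter_upwards [ha, (key s).1 (h1 ⟨s, hs, rfl⟩)] with ω e1 e2
    rw [e1] at e2
    have := EReal.coe_le_coe_iff.1 e2
    linarith
  · rw [le_iff]
    filter_upwards [ha, (key' c).1 (hub c hc)] with ω e1 e2
    rw [e1] at e2
    have := EReal.coe_le_coe_iff.1 e2
    linarith

/-- Multiplication by a nonnegative element preserves greatest lower bounds. -/
theorem le_mul_of_isGLB {S : Set (L0 μ)} {a : L0 μ} (ha : IsGLB S a) (hS : S.Nonempty)
    {ξ l : L0 μ} (hξ : 0 ≤ ξ) (h : ∀ s ∈ S, l ≤ ξ * s) : l ≤ ξ * a := by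
  have hm : MeasurableSet {ω | 0 < ξ ω} := measurableSet_lt measurable_const ξ.measurable
  have hξ' : ∀ᵐ ω ∂μ, 0 ≤ ξ ω := by
    filter_upwards [le_iff.1 hξ, zero_apply (μ := μ)] with ω h h0
    rwa [h0] at h
  -- Dividing by `ξ` is possible only where `ξ > 0`; filling in `a` elsewhere keeps `b` a lower
  -- bound of `S`.
  let b : L0 μ := ind _ hm * (ξ.inv * l) + ind _ hm.compl * a
  have hb : ∀ᵐ ω ∂μ, (0 < ξ ω → b ω = (ξ ω)⁻¹ * l ω) ∧ (¬ 0 < ξ ω → b ω = a ω) := by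
    filter_upwards [add_apply (ind _ hm * (ξ.inv * l)) (ind _ hm.compl * a),
      mul_apply (ind _ hm) (ξ.inv * l), mul_apply (ind _ hm.compl) a, mul_apply ξ.inv l,
      inv_apply ξ, ind_apply (μ := μ) hm, ind_apply (μ := μ) hm.compl] with ω e1 e2 e3 e4 e5 e6 e7
    rw [e1, e2, e3, e4, e5]
    constructor
    · intro h
      rw [e6.1 h, e7.2 (not_not.2 h)]; ring
    · intro h
      rw [e6.2 h, e7.1 h]; ring
  have hba : b ≤ a := ha.2 fun s hs => by
    rw [le_iff]
    filter_upwards [hb, le_iff.1 (h s hs), mul_apply ξ s, le_iff.1 (ha.1 hs)] with ω e1 e2 e3 e4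
    by_cases h : 0 < ξ ω
    · rw [e1.1 h, inv_mul_le_iff₀ h, ← e3]
      exact e2
    · rw [e1.2 h]
      exact e4
  -- Where `ξ = 0` the claim is `l ≤ 0`, which any single member of `S` provides.
  obtain ⟨s, hs⟩ := hS
  rw [le_iff]
  filter_upwards [hb, le_iff.1 hba, mul_apply ξ a, hξ', le_iff.1 (h s hs), mul_apply ξ s]
    with ω e1 e2 e3 e4 e5 e6
  rw [e3]
  by_cases h : 0 < ξ ω
  · rw [e1.1 h, inv_mul_le_iff₀ h] at e2
    exact e2
  · have h0 : ξ ω = 0 := le_antisymm (not_lt.1 h) e4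
    rw [e6, h0, zero_mul] at e5
    rwa [h0, zero_mul]

/-- If `t₁, t₂ ≥ 0`, then `t₁ = ξ (t₁ + t₂)` for some `0 ≤ ξ ≤ 1`. -/
theorem exists_ratio {t₁ t₂ : L0 μ} (h₁ : 0 ≤ t₁) (h₂ : 0 ≤ t₂) :
    ∃ ξ : L0 μ, 0 ≤ ξ ∧ ξ ≤ 1 ∧ (t₁ + t₂) * ξ = t₁ ∧ (t₁ + t₂) * (1 - ξ) = t₂ := by
  have hp : ∀ᵐ ω ∂μ, 0 ≤ t₁ ω ∧ 0 ≤ t₂ ω := by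
    filter_upwards [le_iff.1 h₁, le_iff.1 h₂, zero_apply (μ := μ)] with ω h h' h0
    rw [h0] at h h'
    exact ⟨h, h'⟩
  -- The convention `0 / 0 = 0` is harmless: where `t₁ + t₂ = 0`, both summands vanish.
  let ξ : L0 μ := t₁ * (t₁ + t₂).inv
  have hξ : ∀ᵐ ω ∂μ, ξ ω = t₁ ω / (t₁ ω + t₂ ω) := by
    filter_upwards [mul_apply t₁ (t₁ + t₂).inv, inv_apply (t₁ + t₂), add_apply t₁ t₂]
      with ω e1 e2 e3
    rw [e1, e2, e3, div_eq_mul_inv]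
  have key : (t₁ + t₂) * ξ = t₁ := by
    rw [ext_iff]
    filter_upwards [hp, hξ, mul_apply (t₁ + t₂) ξ, add_apply t₁ t₂] with ω e1 e2 e3 e4
    rw [e3, e4, e2]
    rcases eq_or_ne (t₁ ω + t₂ ω) 0 with h | h
    · rw [h, zero_mul]
      linarith
    · exact mul_div_cancel₀ _ h
  refine ⟨ξ, ?_, ?_, key, ?_⟩
  · rw [le_iff]
    filter_upwards [hp, hξ, zero_apply (μ := μ)] with ω e1 e2 e3
    rw [e2, e3]
    exact div_nonneg e1.1 (add_nonneg e1.1 e1.2)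
  · rw [le_iff]
    filter_upwards [hp, hξ, one_apply (μ := μ)] with ω e1 e2 e3
    rw [e2, e3]
    exact div_le_one_of_le₀ (by linarith) (add_nonneg e1.1 e1.2)
  · rw [mul_sub, key, mul_one, add_sub_cancel_left]

/-- Unlike `a` itself, `a + 1` is nowhere zero, hence a unit of `L⁰`. -/
theorem exists_mul_add_one_eq_one {a : L0 μ} (ha : 0 ≤ a) : ∃ b : L0 μ, 0 ≤ b ∧ b * (a + 1) = 1 := by
  have hp : ∀ᵐ ω ∂μ, 0 < (a + 1) ω := by
    filter_upwards [le_iff.1 ha, zero_apply (μ := μ), add_apply a 1, one_apply (μ := μ)]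
      with ω h h0 h1 h2
    rw [h1, h2]
    rw [h0] at h
    linarith
  refine ⟨(a + 1).inv, ?_, ?_⟩
  · rw [le_iff]
    filter_upwards [hp, inv_apply (a + 1), zero_apply (μ := μ)] with ω h h1 h2
    rw [h1, h2]
    exact (inv_pos.2 h).le
  · rw [ext_iff]
    filter_upwards [hp, inv_apply (a + 1), mul_apply (a + 1).inv (a + 1), one_apply (μ := μ)]
      with ω h h1 h2 h3
    rw [h2, h1, h3, inv_mul_cancel₀ h.ne']

end L0

/-! ### Hahn-Banach theorem for `L⁰`-valued sublinear maps -/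

section HahnBanach

variable {Ω : Type*} [MeasurableSpace Ω] {μ : Measure Ω} {M : Type*} [AddCommGroup M]
  [Module (L0 μ) M]

/-- `L⁰`-sublinear maps: subadditive and positively (sub)homogeneous. -/
structure IsL0Sublinear (q : M → L0 μ) : Prop where
  add_le : ∀ x y, q (x + y) ≤ q x + q y
  smul_le : ∀ (ξ : L0 μ) (x : M), 0 ≤ ξ → q (ξ • x) ≤ ξ * q x

namespace IsL0Sublinear

theorem map_zero {q : M → L0 μ} (hq : IsL0Sublinear q) : q 0 = 0 := by
  refine le_antisymm ?_ ?_
  · simpa using hq.smul_le 0 0 le_rfl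
  · have := hq.add_le 0 0
    rw [add_zero] at this
    exact (le_add_iff_nonneg_left _).1 this

theorem neg_le {q : M → L0 μ} (hq : IsL0Sublinear q) (x : M) : -q (-x) ≤ q x := by
  have := hq.add_le x (-x)
  rw [add_neg_cancel, hq.map_zero] at this
  exact neg_le_iff_add_nonneg.2 this

/-- If `s ≤ q w` for all `(w, s)` in a convex cone `C`, then `q` can be lowered to a sublinear
map which is at most `-s` at `-w` for all `(w, s) ∈ C`. -/
theorem exists_le_of_cone [IsFiniteMeasure μ] {q : M → L0 μ} (hq : IsL0Sublinear q)
    {C : Set (M × L0 μ)} (h0 : (0, 0) ∈ C)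
    (hadd : ∀ a ∈ C, ∀ b ∈ C, a + b ∈ C)
    (hsmul : ∀ ξ : L0 μ, 0 ≤ ξ → ∀ a ∈ C, ξ • a ∈ C)
    (hC : ∀ a ∈ C, a.2 ≤ q a.1) :
    ∃ r : M → L0 μ, IsL0Sublinear r ∧ r ≤ q ∧ ∀ a ∈ C, r (-a.1) ≤ -a.2 := by
  -- The new map is the infimal convolution of `q` with the cone; the hypothesis `hC` and
  -- subadditivity bound it below by `-q (-v)`.
  let S : M → Set (L0 μ) := fun v => (fun a : M × L0 μ => q (v + a.1) - a.2) '' C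
  have hne : ∀ v, (S v).Nonempty := fun v => ⟨_, _, h0, rfl⟩
  have hbdd : ∀ v, BddBelow (S v) := by
    refine fun v => ⟨-q (-v), ?_⟩
    rintro _ ⟨a, ha, rfl⟩
    have h1 := hq.add_le (-v) (v + a.1)
    rw [neg_add_cancel_left] at h1
    have h2 := (hC a ha).trans h1
    dsimp only
    rw [le_sub_iff_add_le, neg_add_le_iff_le_add]
    exact h2
  choose r hr using fun v => L0.exists_isGLB (hne v) (hbdd v)
  have hle : ∀ v, ∀ a ∈ C, r v ≤ q (v + a.1) - a.2 := fun v a ha => (hr v).1 ⟨a, ha, rfl⟩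
  refine ⟨r, ⟨fun x y => ?_, fun ξ x hξ => ?_⟩, fun v => ?_, fun a ha => ?_⟩
  · rw [← sub_le_iff_le_add]
    refine (hr x).2 ?_
    rintro _ ⟨a, ha, rfl⟩
    rw [sub_le_comm]
    refine (hr y).2 ?_
    rintro _ ⟨b, hb, rfl⟩
    rw [sub_le_iff_le_add]
    refine (hle (x + y) _ (hadd a ha b hb)).trans ?_
    have h1 := hq.add_le (x + a.1) (y + b.1)
    rw [show x + a.1 + (y + b.1) = x + y + (a + b).1 by rw [Prod.fst_add]; abel] at h1
    calc q (x + y + (a + b).1) - (a + b).2 ≤ q (x + a.1) + q (y + b.1) - (a + b).2 :=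
          sub_le_sub_right h1 _
      _ = _ := by rw [Prod.snd_add]; ring
  · refine L0.le_mul_of_isGLB (hr x) (hne x) hξ ?_
    rintro _ ⟨a, ha, rfl⟩
    refine (hle (ξ • x) _ (hsmul ξ hξ a ha)).trans ?_
    have h1 := hq.smul_le ξ (x + a.1) hξ
    rw [smul_add] at h1
    dsimp only
    rw [mul_sub]
    exact sub_le_sub_right h1 _
  · simpa using hle v _ h0
  · have := hle (-a.1) a ha
    rwa [neg_add_cancel, hq.map_zero, zero_sub] at this

/-- Since `ξ` may vanish on part of `Ω`, it cannot be inverted. But `ξ + 1` can, which yields `(ξ +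
1) q(x) ≤ q(ξx + x) ≤ q(ξx) + q(x)`. -/
theorem map_smul {q : M → L0 μ} (hq : IsL0Sublinear q) {ξ : L0 μ} (hξ : 0 ≤ ξ) (x : M) :
    q (ξ • x) = ξ * q x := by
  refine le_antisymm (hq.smul_le ξ x hξ) ?_
  obtain ⟨b, hb, hb1⟩ := L0.exists_mul_add_one_eq_one hξ
  have h1 : q x ≤ b * q ((ξ + 1) • x) := by
    simpa [smul_smul, hb1] using hq.smul_le b ((ξ + 1) • x) hb
  have h2 := mul_le_mul_of_nonneg_left h1 (add_nonneg hξ zero_le_one)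
  rw [← mul_assoc, mul_comm (ξ + 1) b, hb1, one_mul, add_smul, one_smul, add_mul, one_mul] at h2
  exact le_of_add_le_add_right (h2.trans (hq.add_le _ _))

/-- A minimal sublinear map is linear. -/
theorem exists_linear_of_minimal [IsFiniteMeasure μ] {m : M → L0 μ} (hm : IsL0Sublinear m)
    (hmin : ∀ r, IsL0Sublinear r → r ≤ m → r = m) : ∃ F : M →ₗ[L0 μ] L0 μ, ⇑F = m := by
  have hneg : ∀ y, m (-y) = -m y := by
    intro y
    -- The cone is the ray through `(y, m y)`. Minimality forces the lowered map to be `m` again, so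
    -- `m (-y) ≤ -m y`.
    obtain ⟨r, hr, hrm, h⟩ := hm.exists_le_of_cone
      (C := {a | ∃ t : L0 μ, 0 ≤ t ∧ a = (t • y, t * m y)}) ⟨0, le_rfl, by simp⟩ (by
        rintro _ ⟨t, ht, rfl⟩ _ ⟨u, hu, rfl⟩
        exact ⟨t + u, add_nonneg ht hu, by simp [add_smul, add_mul]⟩) (by
        rintro ξ hξ _ ⟨t, ht, rfl⟩
        exact ⟨ξ * t, mul_nonneg hξ ht, by simp [mul_smul, mul_assoc]⟩) (by
        rintro _ ⟨t, ht, rfl⟩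
        exact (hm.map_smul ht y).ge)
    have h1 := h (y, m y) ⟨1, zero_le_one, by simp⟩
    rw [hmin r hr hrm] at h1
    exact le_antisymm h1 (_root_.neg_le.1 (by simpa using hm.neg_le y))
  have hadd : ∀ x y, m (x + y) = m x + m y := by
    intro x y
    refine le_antisymm (hm.add_le x y) ?_
    have h1 := hm.add_le (x + y) (-y)
    rw [add_neg_cancel_right, hneg, ← sub_eq_add_neg, le_sub_iff_add_le] at h1
    exact h1
  refine ⟨{ toFun := m, map_add' := hadd, map_smul' := fun ξ x => ?_ }, rfl⟩
  -- Homogeneity is known only for nonnegative scalars, and a general `ξ` has no constant sign.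
  have h1 : ξ • x = ξ⁺ • x + -(ξ⁻ • x) := by
    rw [← sub_eq_add_neg, ← sub_smul, posPart_sub_negPart]
  rw [h1, hadd, hneg, hm.map_smul (posPart_nonneg ξ), hm.map_smul (negPart_nonneg ξ),
    ← sub_eq_add_neg, ← sub_mul, posPart_sub_negPart]
  rfl

/-- The Hahn-Banach theorem: a sublinear map dominates a linear one. -/
theorem exists_linear_le [IsFiniteMeasure μ] {q : M → L0 μ} (hq : IsL0Sublinear q) :
    ∃ F : M →ₗ[L0 μ] L0 μ, ∀ x, F x ≤ q x := by
  obtain ⟨m, hm⟩ : ∃ m : {r : M → L0 μ // IsL0Sublinear r ∧ r ≤ q}, IsMin m := by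
    have : Nonempty {r : M → L0 μ // IsL0Sublinear r ∧ r ≤ q} := ⟨q, hq, le_rfl⟩
    -- In the reversed order, a chain is bounded by its pointwise infimum, which is finite because
    -- every member is at least `-q (-v)` at `v`.
    refine zorn_le_nonempty (α := {r : M → L0 μ // IsL0Sublinear r ∧ r ≤ q}ᵒᵈ) ?_
    intro c hc hne
    replace hc : ∀ h₁ ∈ c, ∀ h₂ ∈ c, ∃ h ∈ c, h.1 ≤ h₁.1 ∧ h.1 ≤ h₂.1 := by
      intro h₁ m₁ h₂ m₂
      rcases hc.total m₁ m₂ with h | h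
      · exact ⟨h₂, m₂, h, le_rfl⟩
      · exact ⟨h₁, m₁, le_rfl, h⟩
    have hne' : ∀ v, ((fun h : {r : M → L0 μ // IsL0Sublinear r ∧ r ≤ q} => h.1 v) '' c).Nonempty :=
      fun v => Set.Nonempty.image _ hne
    choose r hr using fun v => L0.exists_isGLB (hne' v) (by
      refine ⟨-q (-v), ?_⟩
      rintro _ ⟨h, -, rfl⟩
      exact (neg_le_neg (h.2.2 (-v))).trans (h.2.1.neg_le v))
    have hle : ∀ h ∈ c, r ≤ h.1 := fun h hh v => (hr v).1 ⟨h, hh, rfl⟩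
    have hsub : IsL0Sublinear r := by
      refine ⟨fun x y => ?_, fun ξ x hξ => ?_⟩
      · rw [← sub_le_iff_le_add]
        refine (hr x).2 ?_
        rintro _ ⟨h₁, m₁, rfl⟩
        rw [sub_le_comm]
        refine (hr y).2 ?_
        rintro _ ⟨h₂, m₂, rfl⟩
        rw [sub_le_iff_le_add']
        obtain ⟨h, hh, l₁, l₂⟩ := hc h₁ m₁ h₂ m₂
        exact (hle h hh _).trans ((h.2.1.add_le x y).trans (add_le_add (l₁ x) (l₂ y)))
      · refine L0.le_mul_of_isGLB (hr x) (hne' x) hξ ?_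
        rintro _ ⟨h, hh, rfl⟩
        exact (hle h hh _).trans (h.2.1.smul_le ξ x hξ)
    obtain ⟨h₀, hh₀⟩ := hne
    exact ⟨⟨r, hsub, (hle h₀ hh₀).trans h₀.2.2⟩, fun h hh => hle h hh⟩
  obtain ⟨F, hF⟩ := exists_linear_of_minimal m.2.1 fun r hr hrm =>
    le_antisymm hrm (hm (b := ⟨r, hr, hrm.trans m.2.2⟩) hrm)
  exact ⟨F, fun x => by rw [hF]; exact m.2.2 x⟩

/-- If `K` is `L⁰`-convex and `δ ≤ q` on `K` for a sublinear map `q`, then there is a linear map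
`F ≤ q` with `δ ≤ F` on `K`. -/
theorem exists_linear_le_of_convex [IsFiniteMeasure μ] {q : M → L0 μ} (hq : IsL0Sublinear q)
    {K : Set M} (hne : K.Nonempty)
    (hconv : ∀ x ∈ K, ∀ y ∈ K, ∀ ξ : L0 μ, 0 ≤ ξ → ξ ≤ 1 → ξ • x + (1 - ξ) • y ∈ K)
    {δ : L0 μ} (hδ : ∀ k ∈ K, δ ≤ q k) :
    ∃ F : M →ₗ[L0 μ] L0 μ, (∀ x, F x ≤ q x) ∧ ∀ k ∈ K, δ ≤ F k := by
  obtain ⟨k₀, hk₀⟩ := hne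
  -- The cone is generated by `K × {δ}`; convexity of `K` makes it closed under addition. A linear
  -- map below `r` then satisfies `F (-k) ≤ -δ`.
  obtain ⟨r, hr, hrq, h⟩ := hq.exists_le_of_cone
    (C := {a | ∃ t : L0 μ, 0 ≤ t ∧ ∃ k ∈ K, a = (t • k, t * δ)})
    ⟨0, le_rfl, k₀, hk₀, by simp⟩ (by
      rintro _ ⟨t, ht, k, hk, rfl⟩ _ ⟨u, hu, k', hk', rfl⟩
      obtain ⟨ξ, h0, h1, e1, e2⟩ := L0.exists_ratio ht hu
      refine ⟨t + u, add_nonneg ht hu, _, hconv k hk k' hk' ξ h0 h1, ?_⟩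
      rw [smul_add, smul_smul, smul_smul, e1, e2, add_mul]
      rfl) (by
      rintro ξ hξ _ ⟨t, ht, k, hk, rfl⟩
      exact ⟨ξ * t, mul_nonneg hξ ht, k, hk, by simp [mul_smul, mul_assoc]⟩) (by
      rintro _ ⟨t, ht, k, hk, rfl⟩
      exact (mul_le_mul_of_nonneg_left (hδ k hk) ht).trans (hq.map_smul ht k).ge)
  obtain ⟨F, hF⟩ := hr.exists_linear_le
  refine ⟨F, fun x => (hF x).trans (hrq x), fun k hk => ?_⟩
  have h1 := (hF (-k)).trans (h (k, δ) ⟨1, zero_le_one, k, hk, by simp⟩)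
  rw [map_neg] at h1
  exact neg_le_neg_iff.1 h1

end IsL0Sublinear
end HahnBanach

/-! ### Exhaustion in measure, and continuity of dominated functionals -/

section Topology

variable {Ω : Type*} [MeasurableSpace Ω] {μ : Measure Ω}

theorem L0.sum_apply {ι : Type*} (s : Finset ι) (a : ι → L0 μ) :
    ∀ᵐ ω ∂μ, (∑ i ∈ s, a i) ω = ∑ i ∈ s, a i ω := by
  filter_upwards [AEEqFun.coeFn_finsetSum s a] with ω h
  rw [h, Finset.sum_apply]

theorem L0.measurableSet_const_le (ε : ℝ) (a : L0 μ) : MeasurableSet {ω | ε ≤ a ω} :=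
  measurableSet_le measurable_const a.measurable

/-- If `μ {ε ≤ s} ≥ lam` for all members `s` of a downward directed set, then there is a set `A`
with `μ A ≥ lam` on which all members are at least `ε`. -/
theorem L0.exists_set_le_of_directed [IsFiniteMeasure μ] {S : Set (L0 μ)} (hne : S.Nonempty)
    (hdir : ∀ s ∈ S, ∀ t ∈ S, ∃ u ∈ S, u ≤ s ∧ u ≤ t) {ε lam : ℝ}
    (h : ∀ s ∈ S, lam ≤ μ.real {ω | ε ≤ s ω}) :
    ∃ A, MeasurableSet A ∧ lam ≤ μ.real A ∧ ∀ s ∈ S, ∀ᵐ ω ∂μ, ω ∈ A → ε ≤ s ω := by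
  let T : Set ℝ := (fun s : L0 μ => μ.real {ω | ε ≤ s ω}) '' S
  have hT : BddBelow T := ⟨lam, by rintro _ ⟨s, hs, rfl⟩; exact h s hs⟩
  obtain ⟨J, -, hJ, hJm⟩ := exists_seq_tendsto_sInf (hne.image _ : T.Nonempty) hT
  choose s hs hsJ using hJm
  have hlow : ∀ n, ∃ t ∈ S, ∀ i ≤ n, t ≤ s i := by
    intro n
    induction n with
    | zero => exact ⟨s 0, hs 0, fun i hi => by rw [Nat.le_zero.1 hi]⟩
    | succ n ih =>
      obtain ⟨t, ht, h1⟩ := ih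
      obtain ⟨u, hu, h2, h3⟩ := hdir t ht _ (hs (n + 1))
      refine ⟨u, hu, fun i hi => ?_⟩
      rcases Nat.le_succ_iff.1 hi with hi | rfl
      · exact h2.trans (h1 i hi)
      · exact h3
  -- The sequence `s` minimises the measure of `{ε ≤ s}`, so `A` has measure at most the infimum.
  let A : Set Ω := ⋂ n, {ω | ε ≤ s n ω}
  have hA : MeasurableSet A := MeasurableSet.iInter fun n => L0.measurableSet_const_le _ _
  have hAle : μ.real A ≤ sInf T := by
    refine ge_of_tendsto' hJ fun n => ?_
    rw [← hsJ n]
    exact measureReal_mono (Set.iInter_subset _ n)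
  -- Directedness puts a member of `S` below `s 0, …, s n` and `u`, so meeting `A` with `{ε ≤ u}`
  -- does not bring the measure below the infimum. Hence nothing of positive measure is lost.
  have key : ∀ u ∈ S, sInf T ≤ μ.real (A ∩ {ω | ε ≤ u ω}) := by
    intro u hu
    have h1 := tendsto_measure_iInter_le (μ := μ) (f := fun n => {ω | ε ≤ s n ω} ∩ {ω | ε ≤ u ω})
      (fun n => ((L0.measurableSet_const_le _ _).inter
        (L0.measurableSet_const_le _ _)).nullMeasurableSet) ⟨0, measure_ne_top _ _⟩
    rw [← Set.iInter_inter] at h1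
    refine ge_of_tendsto' ((ENNReal.tendsto_toReal (measure_ne_top _ _)).comp h1) fun n => ?_
    obtain ⟨t, ht, ht'⟩ := hlow n
    obtain ⟨v, hv, h2, h3⟩ := hdir t ht u hu
    refine (csInf_le hT ⟨v, hv, rfl⟩).trans ?_
    refine ENNReal.toReal_mono (measure_ne_top _ _) (measure_mono_ae ?_)
    have h4 : ∀ᵐ ω ∂μ, ∀ i, i ≤ n → v ω ≤ s i ω := by
      refine ae_all_iff.2 fun i => ?_
      by_cases hi : i ≤ n
      · filter_upwards [L0.le_iff.1 (h2.trans (ht' i hi))] with ω h _ using h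
      · exact Eventually.of_forall fun ω h => (hi h).elim
    filter_upwards [h4, L0.le_iff.1 h3] with ω h5 h6 h7
    exact Set.mem_iInter₂.2 fun i hi => ⟨le_trans h7 (h5 i hi), le_trans h7 h6⟩
  refine ⟨A, hA, ?_, fun u hu => ?_⟩
  · obtain ⟨u, hu⟩ := hne
    have h1 : lam ≤ sInf T := le_csInf ⟨_, u, hu, rfl⟩ (by rintro _ ⟨s, hs, rfl⟩; exact h s hs)
    exact h1.trans ((key u hu).trans (measureReal_mono Set.inter_subset_left))
  · have h1 : μ.real (A \ {ω | ε ≤ u ω}) = 0 := by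
      have h2 := measureReal_inter_add_sdiff (μ := μ) (s := A) (L0.measurableSet_const_le ε u)
      have h3 := key u hu
      have h4 : 0 ≤ μ.real (A \ {ω | ε ≤ u ω}) := measureReal_nonneg
      linarith
    rw [measureReal_eq_zero_iff] at h1
    filter_upwards [measure_eq_zero_iff_ae_notMem.1 h1] with ω h2 h3
    by_contra h4
    exact h2 ⟨h3, h4⟩

theorem L0.exists_nat_measure_lt [IsProbabilityMeasure μ] (ξ : L0 μ) {lam : ℝ} (hl : 0 < lam) :
    ∃ n : ℕ, 1 - lam < μ.real {ω | ξ ω < n} := by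
  have h1 : Tendsto (fun n : ℕ => μ {ω | ξ ω < n}) atTop (𝓝 (μ (⋃ n : ℕ, {ω | ξ ω < n}))) :=
    tendsto_measure_iUnion_atTop fun m n hmn ω (h : ξ ω < m) =>
      h.trans_le (Nat.cast_le.2 hmn)
  have h2 : (⋃ n : ℕ, {ω | ξ ω < n}) = Set.univ := by
    ext ω
    simpa using exists_nat_gt (ξ ω)
  rw [h2] at h1
  have h3 := (ENNReal.tendsto_toReal (measure_ne_top _ _)).comp h1
  have h4 : (μ Set.univ).toReal = 1 := by simp
  rw [h4] at h3
  exact (h3.eventually (lt_mem_nhds (by linarith : 1 - lam < 1))).exists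

variable {E : Type*} [AddCommGroup E] [Module (L0 μ) E]

/-- `g` is dominated by an `L⁰`-multiple of a finite sum of members of `P`. -/
def IsSeminormDominated (P : Set (E → L0 μ)) (g : E →ₗ[L0 μ] L0 μ) : Prop :=
  ∃ (Q : Finset (E → L0 μ)) (ξ : L0 μ), (Q : Set (E → L0 μ)) ⊆ P ∧ 0 ≤ ξ ∧
    ∀ v, |g v| ≤ ξ * ∑ p ∈ Q, p v

theorem IsRLCModule.sum_nonneg {P : Set (E → L0 μ)} (hP : IsRLCModule P)
    {Q : Finset (E → L0 μ)} (hQ : (Q : Set (E → L0 μ)) ⊆ P) (v : E) : 0 ≤ ∑ p ∈ Q, p v :=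
  Finset.sum_nonneg fun p hp => (hP.seminorm p (hQ hp)).nonneg v

theorem IsSeminormDominated.smul {P : Set (E → L0 μ)}
    {g : E →ₗ[L0 μ] L0 μ} (hg : IsSeminormDominated P g) (η : L0 μ) :
    IsSeminormDominated P (η • g) := by
  obtain ⟨Q, ξ, hQ, hξ, h⟩ := hg
  refine ⟨Q, |η| * ξ, hQ, mul_nonneg (abs_nonneg _) hξ, fun v => ?_⟩
  rw [LinearMap.smul_apply, smul_eq_mul, L0.abs_mul, mul_assoc]
  exact mul_le_mul_of_nonneg_left (h v) (abs_nonneg _)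

theorem IsSeminormDominated.add {P : Set (E → L0 μ)} (hP : IsRLCModule P)
    {g g' : E →ₗ[L0 μ] L0 μ} (hg : IsSeminormDominated P g) (hg' : IsSeminormDominated P g') :
    IsSeminormDominated P (g + g') := by
  classical
  obtain ⟨Q, ξ, hQ, hξ, h⟩ := hg
  obtain ⟨Q', ξ', hQ', hξ', h'⟩ := hg'
  have hQQ : ((Q ∪ Q' : Finset (E → L0 μ)) : Set (E → L0 μ)) ⊆ P := by
    rw [Finset.coe_union]
    exact Set.union_subset hQ hQ'
  refine ⟨Q ∪ Q', ξ + ξ', hQQ, add_nonneg hξ hξ', fun v => ?_⟩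
  have h1 : ∑ p ∈ Q, p v ≤ ∑ p ∈ Q ∪ Q', p v :=
    Finset.sum_le_sum_of_subset_of_nonneg Finset.subset_union_left fun p hp _ =>
      (hP.seminorm p (hQQ hp)).nonneg v
  have h2 : ∑ p ∈ Q', p v ≤ ∑ p ∈ Q ∪ Q', p v :=
    Finset.sum_le_sum_of_subset_of_nonneg Finset.subset_union_right fun p hp _ =>
      (hP.seminorm p (hQQ hp)).nonneg v
  rw [add_mul]
  refine (abs_add_le _ _).trans (add_le_add ?_ ?_)
  · exact (h v).trans (mul_le_mul_of_nonneg_left h1 hξ)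
  · exact (h' v).trans (mul_le_mul_of_nonneg_left h2 hξ')

/-- The random factor `ξ` is below a constant `N` outside a set of small probability, and there the
domination is an ordinary Lipschitz bound. -/
theorem IsSeminormDominated.continuous [IsProbabilityMeasure μ] {P : Set (E → L0 μ)}
    (hP : IsRLCModule P) {g : E →ₗ[L0 μ] L0 μ} (hg : IsSeminormDominated P g) :
    Continuous[epsLamTopology P, L0EpsLamTopology μ] g := by
  obtain ⟨Q, ξ, hQ, hξ, h⟩ := hg
  refine @Continuous.mk _ _ (epsLamTopology P) (L0EpsLamTopology μ) _ fun U hU x hx => ?_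
  obtain ⟨Q', hQ', -, ε, lam, hε, hl, hl1, hU'⟩ := hU (g x) hx
  obtain ⟨N, hN⟩ := L0.exists_nat_measure_lt ξ (half_pos hl)
  -- The `+ 1` keeps the denominator positive when `N` or `Q.card` is zero, and makes the final
  -- bound strict.
  set δ : ℝ := ε / (N * Q.card + 1) with hδ
  have hpos : (0 : ℝ) < N * Q.card + 1 := by positivity
  refine ⟨Q, hQ, Q.finite_toSet, δ, lam / 2, by positivity, by positivity, by linarith,
    fun y hy => hU' (g y) ?_⟩
  have hy' : 1 - lam / 2 < μ.real {ω | ∀ p ∈ (Q : Set (E → L0 μ)), p (y - x) ω < δ} := hy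
  set D := {ω | ∀ p ∈ (Q : Set (E → L0 μ)), p (y - x) ω < δ}
  set G := {ω | ξ ω < N}
  have hG : MeasurableSet G := measurableSet_lt ξ.measurable measurable_const
  have h1 : 1 - lam < μ.real (D ∩ G) := by
    have e1 := measureReal_inter_add_sdiff (μ := μ) (s := D) hG
    have e2 : μ.real (D \ G) ≤ μ.real Gᶜ := measureReal_mono fun ω hω => hω.2
    have e3 := probReal_compl_eq_one_sub (μ := μ) hG
    linarith
  refine h1.trans_le (ENNReal.toReal_mono (measure_ne_top _ _) (measure_mono_ae ?_))
  have hnn : ∀ᵐ ω ∂μ, ∀ p : Q, 0 ≤ p.1 (y - x) ω := by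
    refine ae_all_iff.2 fun p => ?_
    filter_upwards [L0.le_iff.1 ((hP.seminorm p (hQ p.2)).nonneg (y - x)),
      L0.zero_apply (μ := μ)] with ω e1 e2
    rwa [e2] at e1
  have hle := L0.le_iff.1 (h (y - x))
  rw [map_sub] at hle
  filter_upwards [hnn, hle, L0.mul_apply ξ (∑ p ∈ Q, p (y - x)),
    L0.sum_apply Q (fun p => p (y - x))] with ω e1 e2 e3 e4 hω p hp
  rw [Set.mem_singleton_iff.1 (hQ' hp)]
  refine e2.trans_lt ?_
  rw [e3, e4]
  have e5 : 0 ≤ ∑ p ∈ Q, p (y - x) ω := Finset.sum_nonneg fun p hp => e1 ⟨p, hp⟩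
  have e6 : ∑ p ∈ Q, p (y - x) ω ≤ Q.card * δ := by
    have := Finset.sum_le_card_nsmul Q (fun p => p (y - x) ω) δ fun p hp => (hω.1 p hp).le
    rwa [nsmul_eq_mul] at this
  have e7 : ξ ω ≤ N := le_of_lt hω.2
  calc ξ ω * ∑ p ∈ Q, p (y - x) ω ≤ N * (Q.card * δ) :=
        (mul_le_mul_of_nonneg_right e7 e5).trans (mul_le_mul_of_nonneg_left e6 (Nat.cast_nonneg _))
    _ < (N * Q.card + 1) * δ := by
        have : 0 < δ := by positivity
        linarith
    _ = ε := mul_div_cancel₀ _ hpos.ne'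

end Topology

/-! ### Gluing along measurable sets, and distance to the epigraph -/

section Separation

variable {Ω : Type*} [MeasurableSpace Ω] {μ : Measure Ω} {E : Type*} [AddCommGroup E]
  [Module (L0 μ) E]

/-- The element of `E` which is `x` on `A` and `y` off `A`. -/
def L0.glue {A : Set Ω} (hA : MeasurableSet A) (x y : E) : E :=
  (L0.ind A hA : L0 μ) • x + (1 - (L0.ind A hA : L0 μ)) • y

theorem L0.map_glue {A : Set Ω} (hA : MeasurableSet A) (g : E →ₗ[L0 μ] L0 μ) (x y : E) :
    ∀ᵐ ω ∂μ, (ω ∈ A → g (L0.glue (μ := μ) hA x y) ω = g x ω) ∧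
      (ω ∉ A → g (L0.glue (μ := μ) hA x y) ω = g y ω) := by
  rw [L0.glue, map_add, map_smul, map_smul, ← L0.ind_compl hA, smul_eq_mul, smul_eq_mul]
  filter_upwards [L0.add_apply (L0.ind A hA * g x) (L0.ind Aᶜ hA.compl * g y),
    L0.mul_apply (L0.ind A hA) (g x), L0.mul_apply (L0.ind Aᶜ hA.compl) (g y),
    L0.ind_apply (μ := μ) hA, L0.ind_apply (μ := μ) hA.compl] with ω e1 e2 e3 e4 e5
  rw [e1, e2, e3]
  constructor
  · intro h
    rw [e4.1 h, e5.2 (not_not.2 h)]; ring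
  · intro h
    rw [e4.2 h, e5.1 h]; ring

theorem L0.glue_apply {A : Set Ω} (hA : MeasurableSet A) (a b : L0 μ) :
    ∀ᵐ ω ∂μ, (ω ∈ A → (L0.glue (μ := μ) hA a b : L0 μ) ω = a ω) ∧
      (ω ∉ A → (L0.glue (μ := μ) hA a b : L0 μ) ω = b ω) :=
  L0.map_glue hA LinearMap.id a b

theorem L0.glue_mk {A : Set Ω} (hA : MeasurableSet A) (x y : E) (a b : L0 μ) :
    L0.glue (μ := μ) hA (x, a) (y, b) = (L0.glue (μ := μ) hA x y, L0.glue (μ := μ) hA a b) :=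
  rfl

theorem L0.sub_glue {A : Set Ω} (hA : MeasurableSet A) (x y : E) :
    y - L0.glue (μ := μ) hA x y = (L0.ind A hA : L0 μ) • (y - x) := by
  rw [L0.glue, sub_smul, one_smul, smul_sub]
  abel

theorem IsL0Convex.apply_glue {f : E → L0bar μ} (hf : IsL0Convex f) {A : Set Ω}
    (hA : MeasurableSet A) (x y : E) :
    ∀ᵐ ω ∂μ, (ω ∈ A → f (L0.glue (μ := μ) hA x y) ω ≤ f x ω) ∧
      (ω ∉ A → f (L0.glue (μ := μ) hA x y) ω ≤ f y ω) := by
  filter_upwards [hf x y (L0.ind A hA) (L0.ind_nonneg hA) (L0.ind_le_one hA),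
    L0.ind_apply (μ := μ) hA] with ω h1 h2
  refine ⟨fun h => h1.trans ?_, fun h => h1.trans ?_⟩
  · rw [h2.1 h, addTop]
    simp only [EReal.coe_one, one_mul, sub_self, EReal.coe_zero, zero_mul, add_zero]
    split_ifs with h3
    · simpa using h3.symm
    · exact le_rfl
  · rw [h2.2 h, addTop]
    simp only [EReal.coe_one, one_mul, sub_zero, EReal.coe_zero, zero_mul, zero_add]
    split_ifs with h3
    · simpa using h3.symm
    · exact le_rfl

/-- Gluing the glued point once more with `x` off `A` recovers `x`, so `apply_glue` can be read
backwards: on `A`, `f` sees only the part of its argument on `A`. -/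
theorem IsL0Convex.le_apply_glue {f : E → L0bar μ} (hf : IsL0Convex f) {A : Set Ω}
    (hA : MeasurableSet A) (x y : E) :
    ∀ᵐ ω ∂μ, ω ∈ A → f x ω ≤ f (L0.glue (μ := μ) hA x y) ω := by
  have h1 : L0.glue (μ := μ) hA (L0.glue (μ := μ) hA x y) x = x := by
    set a : L0 μ := L0.ind A hA with ha
    have h2 : a * a = a := L0.ind_mul_self hA
    rw [L0.glue, L0.glue, ← ha, smul_add, smul_smul, smul_smul, h2, mul_sub, h2, mul_one, sub_self,
      zero_smul, add_zero, sub_smul, one_smul, add_sub_cancel]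
  filter_upwards [hf.apply_glue hA (L0.glue (μ := μ) hA x y) x] with ω h2 h3
  have := h2.1 h3
  rwa [h1] at this

theorem IsL0Convex.epi_convex {f : E → L0bar μ} (hf : IsL0Convex f)
    (hbot : ∀ x, ∀ᵐ ω ∂μ, ⊥ < f x ω) {z w : E × L0 μ} (hz : z ∈ L0Epi f) (hw : w ∈ L0Epi f)
    {ξ : L0 μ} (h0 : 0 ≤ ξ) (h1 : ξ ≤ 1) : ξ • z + (1 - ξ) • w ∈ L0Epi f := by
  have hz' : f z.1 ≤ z.2.toBar := hz
  have hw' : f w.1 ≤ w.2.toBar := hw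
  change f (ξ • z.1 + (1 - ξ) • w.1) ≤ (ξ * z.2 + (1 - ξ) * w.2).toBar
  rw [← AEEqFun.coeFn_le] at hz' hw' ⊢
  filter_upwards [hf z.1 w.1 ξ h0 h1, hz', hw', hbot z.1, hbot w.1, L0.toBar_apply z.2,
    L0.toBar_apply w.2, L0.toBar_apply (ξ * z.2 + (1 - ξ) * w.2),
    L0.add_apply (ξ * z.2) ((1 - ξ) * w.2), L0.mul_apply ξ z.2, L0.mul_apply (1 - ξ) w.2,
    L0.sub_apply 1 ξ, L0.one_apply (μ := μ), L0.zero_apply (μ := μ), L0.le_iff.1 h0,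
    L0.le_iff.1 h1] with ω c1 c2 c3 c4 c5 e1 e2 e3 e4 e5 e6 e7 e8 e9 c6 c7
  refine c1.trans ?_
  rw [e1] at c2
  rw [e2] at c3
  rw [e9] at c6
  rw [e8] at c7
  rw [e3, e4, e5, e6, e7, e8]
  lift f z.1 ω to ℝ using ⟨(c2.trans_lt (EReal.coe_lt_top _)).ne, c4.ne'⟩ with a
  lift f w.1 ω to ℝ using ⟨(c3.trans_lt (EReal.coe_lt_top _)).ne, c5.ne'⟩ with b
  rw [EReal.coe_le_coe_iff] at c2 c3
  rw [addTop, ← EReal.coe_mul, ← EReal.coe_mul, if_neg (by simp [-EReal.coe_mul]), ← EReal.coe_add,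
    EReal.coe_le_coe_iff]
  exact add_le_add (mul_le_mul_of_nonneg_left c2 c6)
    (mul_le_mul_of_nonneg_left c3 (sub_nonneg.2 c7))

/-- A point of the effective domain together with a real-valued version of its value. -/
theorem IsL0Proper.exists_eq_toBar {X : Type*} {f : X → L0bar μ} (hf : IsL0Proper f) :
    ∃ (x : X) (r : L0 μ), f x = r.toBar := by
  obtain ⟨⟨x, hx⟩, -⟩ := hf
  refine ⟨x, AEEqFun.compMeasurable EReal.toReal measurable_ereal_toReal (f x), ?_⟩
  refine AEEqFun.ext ?_
  filter_upwards [hx, L0.toBar_apply (AEEqFun.compMeasurable EReal.toReal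
    measurable_ereal_toReal (f x)), AEEqFun.coeFn_compMeasurable EReal.toReal
    measurable_ereal_toReal (f x)] with ω h h1 h2
  rw [h1, h2]
  exact (EReal.coe_toReal h.2.ne h.1.ne').symm

/-- The `L⁰`-seminorm `(v, r) ↦ ∑ p ∈ Q, p v + |r|`. -/
def sumSeminorm (Q : Finset (E → L0 μ)) (z : E × L0 μ) : L0 μ := ∑ p ∈ Q, p z.1 + |z.2|

theorem IsRLCModule.isL0Seminorm_sumSeminorm {P : Set (E → L0 μ)} (hP : IsRLCModule P)
    {Q : Finset (E → L0 μ)} (hQ : (Q : Set (E → L0 μ)) ⊆ P) : IsL0Seminorm (sumSeminorm Q) where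
  nonneg z := add_nonneg (hP.sum_nonneg hQ _) (abs_nonneg _)
  smul ξ z := by
    rw [sumSeminorm, sumSeminorm, mul_add, Finset.mul_sum, Prod.smul_fst, Prod.smul_snd,
      smul_eq_mul, L0.abs_mul]
    congr 1
    exact Finset.sum_congr rfl fun p hp => (hP.seminorm p (hQ hp)).smul ξ z.1
  add_le z w := by
    refine (add_le_add (Finset.sum_le_sum fun p hp => (hP.seminorm p (hQ hp)).add_le z.1 w.1)
      (abs_add_le z.2 w.2)).trans ?_
    rw [Finset.sum_add_distrib, add_add_add_comm]
    rfl

theorem IsL0Seminorm.isL0Sublinear {p : E → L0 μ} (hp : IsL0Seminorm p) : IsL0Sublinear p where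
  add_le := hp.add_le
  smul_le ξ x hξ := by rw [hp.smul, abs_of_nonneg hξ]

theorem IsL0Seminorm.map_neg {p : E → L0 μ} (hp : IsL0Seminorm p) (x : E) : p (-x) = p x := by
  rw [← neg_one_smul (L0 μ), hp.smul, abs_neg, abs_of_nonneg zero_le_one, one_mul]

theorem IsL0Seminorm.apply_glue_le {p : E → L0 μ} (hp : IsL0Seminorm p) {A : Set Ω}
    (hA : MeasurableSet A) (x y : E) : ∀ᵐ ω ∂μ,
      (ω ∈ A → p (L0.glue (μ := μ) hA x y) ω ≤ p x ω) ∧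
        (ω ∉ A → p (L0.glue (μ := μ) hA x y) ω ≤ p y ω) := by
  have h1 : p (L0.glue (μ := μ) hA x y) ≤ L0.glue (μ := μ) hA (p x) (p y) := by
    refine (hp.add_le _ _).trans ?_
    rw [hp.smul, hp.smul, abs_of_nonneg (L0.ind_nonneg hA),
      abs_of_nonneg (sub_nonneg.2 (L0.ind_le_one hA))]
    rfl
  filter_upwards [L0.le_iff.1 h1, L0.glue_apply hA (p x) (p y)] with ω h2 h3
  exact ⟨fun h => h2.trans (h3.1 h).le, fun h => h2.trans (h3.2 h).le⟩

/-- A point outside a closed `L⁰`-convex epigraph has positive distance to it, measured by a finite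
family of seminorms. -/
theorem exists_measure_sumSeminorm_ge [IsProbabilityMeasure μ] {P : Set (E → L0 μ)}
    (hP : IsRLCModule P) {f : E → L0bar μ} (hlsc : IsEpsLamLSC P f) {z₀ : E × L0 μ}
    (hz₀ : z₀ ∉ L0Epi f) :
    ∃ (Q : Finset (E → L0 μ)) (ε lam : ℝ), (Q : Set (E → L0 μ)) ⊆ P ∧ 0 < ε ∧ 0 < lam ∧
      ∀ z ∈ L0Epi f, lam ≤ μ.real {ω | ε ≤ sumSeminorm Q (z - z₀) ω} := by
  obtain ⟨u, v, hu, hv, hzu, hzv, huv⟩ := (@isOpen_prod_iff E (L0 μ) (epsLamTopology P)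
    (L0EpsLamTopology μ) _).1 hlsc.isOpen_compl z₀.1 z₀.2 hz₀
  obtain ⟨Q, hQ, hQf, ε, lam, hε, hl, -, h⟩ := hu _ hzu
  obtain ⟨Q', hQ', -, ε', lam', hε', hl', -, h'⟩ := hv _ hzv
  have hQP : (hQf.toFinset : Set (E → L0 μ)) ⊆ P := by simpa using hQ
  refine ⟨hQf.toFinset, min ε ε', min lam lam', hQP, lt_min hε hε', lt_min hl hl', fun z hz => ?_⟩
  -- The sum dominates each seminorm and `|·|`. Were it small with probability above `1 - min lam
  -- lam'`, `z` would lie in the box `u × v`, which misses the epigraph.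
  by_contra! hlt
  set q := sumSeminorm hQf.toFinset (z - z₀) with hq
  have h1 : 1 - min lam lam' < μ.real {ω | q ω < min ε ε'} := by
    have h2 := probReal_compl_eq_one_sub (μ := μ) (L0.measurableSet_const_le (min ε ε') q)
    have h3 : {ω | min ε ε' ≤ q ω}ᶜ = {ω | q ω < min ε ε'} := by
      ext ω
      simp
    rw [h3] at h2
    linarith
  have hnn : ∀ᵐ ω ∂μ, ∀ p : hQf.toFinset, 0 ≤ p.1 (z - z₀).1 ω := by
    refine ae_all_iff.2 fun p => ?_
    filter_upwards [L0.le_iff.1 ((hP.seminorm p (hQP p.2)).nonneg (z - z₀).1),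
      L0.zero_apply (μ := μ)] with ω e1 e2
    rwa [e2] at e1
  have hq' : ∀ᵐ ω ∂μ, q ω = ∑ p ∈ hQf.toFinset, p (z - z₀).1 ω + |(z - z₀).2 ω| := by
    filter_upwards [L0.add_apply (∑ p ∈ hQf.toFinset, p (z - z₀).1) |(z - z₀).2|,
      L0.sum_apply hQf.toFinset (fun p => p (z - z₀).1), L0.abs_apply (z - z₀).2] with ω e1 e2 e3
    rw [← e2, ← e3, ← e1]
    rfl
  refine huv (Set.mk_mem_prod (h z.1 ?_) (h' z.2 ?_)) hz
  · change 1 - lam < μ.real {ω | ∀ p ∈ Q, p (z.1 - z₀.1) ω < ε}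
    refine (sub_le_sub_left (min_le_left _ _) 1).trans_lt (h1.trans_le ?_)
    refine ENNReal.toReal_mono (measure_ne_top _ _) (measure_mono_ae ?_)
    filter_upwards [hnn, hq'] with ω e1 e2 (e3 : q ω < _) p hp
    have h4 : p (z.1 - z₀.1) ω ≤ _ := Finset.single_le_sum (f := fun p : E → L0 μ => p (z - z₀).1 ω)
      (fun p hp => e1 ⟨p, hp⟩) (hQf.mem_toFinset.2 hp)
    have h5 := abs_nonneg ((z - z₀).2 ω)
    exact lt_of_le_of_lt (by linarith) (e3.trans_le (min_le_left _ _))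
  · change 1 - lam' < μ.real {ω | ∀ p ∈ Q', p (z.2 - z₀.2) ω < ε'}
    refine (sub_le_sub_left (min_le_right _ _) 1).trans_lt (h1.trans_le ?_)
    refine ENNReal.toReal_mono (measure_ne_top _ _) (measure_mono_ae ?_)
    filter_upwards [hnn, hq', L0.abs_apply (z - z₀).2] with ω e1 e2 e4 (e3 : q ω < _) p hp
    rw [Set.mem_singleton_iff.1 (hQ' hp)]
    have h4 : 0 ≤ ∑ p ∈ hQf.toFinset, p (z - z₀).1 ω := Finset.sum_nonneg fun p hp => e1 ⟨p, hp⟩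
    change |(z - z₀).2| ω < ε'
    rw [e4]
    exact lt_of_le_of_lt (by linarith) (e3.trans_le (min_le_right _ _))

end Separation

/-! ### Strict separation from the epigraph -/

section Minorants

variable {Ω : Type*} [MeasurableSpace Ω] {μ : Measure Ω} {E : Type*} [AddCommGroup E]
  [Module (L0 μ) E]

/-- Strict separation of a point from a closed `L⁰`-convex epigraph on a set of positive measure:
if `z₀` agrees with a point of the epigraph off `B` and lies outside, then there is a functional
`F`, dominated by finitely many seminorms, which is at least `ε > 0` on the translated epigraph
on some non-negligible `A ⊆ B`. -/
theorem exists_functional_of_notMem_epi [IsProbabilityMeasure μ] {P : Set (E → L0 μ)}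
    (hP : IsRLCModule P) {f : E → L0bar μ} (hbot : ∀ x, ∀ᵐ ω ∂μ, ⊥ < f x ω)
    (hconvex : IsL0Convex f) (hlsc : IsEpsLamLSC P f) {z₁ : E × L0 μ} (hz₁ : z₁ ∈ L0Epi f)
    (z₀ : E × L0 μ) {B : Set Ω} (hB : MeasurableSet B)
    (hz₀ : L0.glue (μ := μ) hB z₀ z₁ ∉ L0Epi f) :
    ∃ (A : Set Ω) (Q : Finset (E → L0 μ)) (F : E × L0 μ →ₗ[L0 μ] L0 μ) (ε : ℝ),
      MeasurableSet A ∧ A ⊆ B ∧ 0 < μ.real A ∧ (Q : Set (E → L0 μ)) ⊆ P ∧ 0 < ε ∧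
      (∀ z, F z ≤ sumSeminorm Q z) ∧
      ∀ z ∈ L0Epi f, ∀ᵐ ω ∂μ, ω ∈ A → ε ≤ F (z - z₀) ω := by
  set w := L0.glue (μ := μ) hB z₀ z₁ with hw
  obtain ⟨Q, ε, lam, hQ, hε, hl, hdist⟩ := exists_measure_sumSeminorm_ge hP hlsc hz₀
  have hq := hP.isL0Seminorm_sumSeminorm hQ
  set q := sumSeminorm Q
  let K : Set (E × L0 μ) := {k | k + w ∈ L0Epi f}
  have hK : ∀ z ∈ L0Epi f, z - w ∈ K := fun z hz => by simpa [K] using hz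
  have hKconv : ∀ x ∈ K, ∀ y ∈ K, ∀ ξ : L0 μ, 0 ≤ ξ → ξ ≤ 1 → ξ • x + (1 - ξ) • y ∈ K := by
    intro x hx y hy ξ h0 h1
    have h2 := hconvex.epi_convex hbot hx hy h0 h1
    have h3 : ξ • (x + w) + (1 - ξ) • (y + w) = ξ • x + (1 - ξ) • y + w := by
      rw [smul_add, smul_add, sub_smul 1 ξ w, one_smul]
      abel
    rwa [h3] at h2
  have hKne : K.Nonempty := ⟨_, hK z₁ hz₁⟩
  -- Directedness: gluing `k` and `k'` along `{q k ≤ q k'}` stays in `K`, and its seminorm is at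
  -- most the minimum of both.
  obtain ⟨A, hA, hlA, hAε⟩ := L0.exists_set_le_of_directed (μ := μ) (S := q '' K) (ε := ε)
    (lam := lam) (hKne.image _) (by
      rintro _ ⟨k, hk, rfl⟩ _ ⟨k', hk', rfl⟩
      have hm : MeasurableSet {ω | q k ω ≤ q k' ω} := measurableSet_le (q k).measurable
        (q k').measurable
      refine ⟨_, ⟨L0.glue (μ := μ) hm k k',
        hKconv k hk k' hk' _ (L0.ind_nonneg hm) (L0.ind_le_one hm), rfl⟩, ?_, ?_⟩
      · rw [L0.le_iff]
        filter_upwards [hq.apply_glue_le hm k k'] with ω h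
        by_cases hω : q k ω ≤ q k' ω
        · exact h.1 hω
        · exact (h.2 hω).trans (not_le.1 hω).le
      · rw [L0.le_iff]
        filter_upwards [hq.apply_glue_le hm k k'] with ω h
        by_cases hω : q k ω ≤ q k' ω
        · exact (h.1 hω).trans hω
        · exact h.2 hω) (by
      rintro _ ⟨k, hk, rfl⟩
      have := hdist _ hk
      rwa [add_sub_cancel_right] at this)
  -- The difference `z₁ - w` vanishes off `B`, yet its seminorm is at least `ε` on `A`.
  have hAB : ∀ᵐ ω ∂μ, ω ∈ A → ω ∈ B := by
    have h1 := hAε _ ⟨_, hK z₁ hz₁, rfl⟩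
    rw [hw, L0.sub_glue, hq.smul, abs_of_nonneg (L0.ind_nonneg hB)] at h1
    filter_upwards [h1, L0.mul_apply (L0.ind B hB) (q (z₁ - z₀)), L0.ind_apply (μ := μ) hB]
      with ω e1 e2 e3 e4
    by_contra hω
    have h2 := e1 e4
    rw [e2, e3.2 hω, zero_mul] at h2
    linarith
  have hAB' : MeasurableSet (A ∩ B) := hA.inter hB
  have hδ : ∀ k ∈ K, L0.const ε * L0.ind (A ∩ B) hAB' ≤ q k := by
    intro k hk
    rw [L0.le_iff]
    filter_upwards [hAε _ ⟨k, hk, rfl⟩, L0.le_iff.1 (hq.nonneg k), L0.zero_apply (μ := μ),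
      L0.mul_apply (L0.const ε) (L0.ind (A ∩ B) hAB'), L0.const_apply (μ := μ) ε,
      L0.ind_apply (μ := μ) hAB'] with ω e1 e2 e3 e4 e5 e6
    rw [e4, e5]
    by_cases hω : ω ∈ A ∩ B
    · rw [e6.1 hω, mul_one]
      exact e1 hω.1
    · rw [e6.2 hω, mul_zero, ← e3]
      exact e2
  obtain ⟨F, hF, hFK⟩ := hq.isL0Sublinear.exists_linear_le_of_convex hKne hKconv hδ
  refine ⟨A ∩ B, Q, F, ε, hAB', Set.inter_subset_right, ?_, hQ, hε, hF, fun z hz => ?_⟩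
  · refine (hl.trans_le hlA).trans_le (ENNReal.toReal_mono (measure_ne_top _ _)
      (measure_mono_ae ?_))
    filter_upwards [hAB] with ω h1 h2
    exact ⟨h2, h1 h2⟩
  · have h1 := hFK _ (hK z hz)
    rw [map_sub] at h1 ⊢
    filter_upwards [L0.le_iff.1 h1, L0.mul_apply (L0.const ε) (L0.ind (A ∩ B) hAB'),
      L0.const_apply (μ := μ) ε, L0.ind_apply (μ := μ) hAB', L0.map_glue hB F z₀ z₁,
      L0.sub_apply (F z) (F w), L0.sub_apply (F z) (F z₀)] with ω e1 e2 e3 e4 e5 e6 e7 hω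
    rw [e2, e3, e4.1 hω, mul_one, e6, hw, e5.1 hω.2] at e1
    rwa [e7]

/-- If `η < f(x₀)` on the non-negligible set `B`, then on a non-negligible part of `B` the point
`(x₀, η)` is strictly separated from the epigraph of `f` by a dominated functional. -/
theorem exists_separation [IsProbabilityMeasure μ] {P : Set (E → L0 μ)} (hP : IsRLCModule P)
    {f : E → L0bar μ} (hproper : IsL0Proper f) (hconvex : IsL0Convex f) (hlsc : IsEpsLamLSC P f)
    (x₀ : E) (η : L0 μ) {B : Set Ω} (hB : MeasurableSet B) (hμB : 0 < μ.real B)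
    (hη : ∀ᵐ ω ∂μ, ω ∈ B → (η ω : EReal) < f x₀ ω) :
    ∃ (A : Set Ω) (g : E →ₗ[L0 μ] L0 μ) (β : L0 μ) (ε : ℝ),
      MeasurableSet A ∧ A ⊆ B ∧ 0 < μ.real A ∧ IsSeminormDominated P g ∧ 0 < ε ∧
      (∀ᵐ ω ∂μ, ω ∈ A → 0 ≤ β ω) ∧
      ∀ x r, f x ≤ L0.toBar r → ∀ᵐ ω ∂μ, ω ∈ A → ε + g x ω - g x₀ ω ≤ β ω * (r ω - η ω) := by
  obtain ⟨x₁, r₁, h₁⟩ := hproper.exists_eq_toBar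
  obtain ⟨A, Q, F, ε, hA, hAB, hμA, hQ, hε, hFq, hF⟩ := exists_functional_of_notMem_epi hP
    hproper.2 hconvex hlsc (z₁ := (x₁, r₁)) h₁.le (x₀, η) hB (by
      -- By locality, `f` at the glued point is at least `f x₀ > η` on `B`, so membership would make
      -- `B` negligible.
      rw [L0.glue_mk]
      intro hmem
      replace hmem : f _ ≤ L0.toBar _ := hmem
      rw [← AEEqFun.coeFn_le] at hmem
      refine hμB.ne' ((measureReal_eq_zero_iff).2 (measure_eq_zero_iff_ae_notMem.2 ?_))
      filter_upwards [hmem, L0.toBar_apply (L0.glue (μ := μ) hB η r₁), L0.glue_apply hB η r₁, hη,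
        hconvex.le_apply_glue hB x₀ x₁] with ω e1 e2 e3 e4 e5 hω
      rw [e2, e3.1 hω] at e1
      exact (e4 hω).not_ge ((e5 hω).trans e1))
  have hFapply : ∀ x r, F (x, r) = F (x, 0) + r * F (0, 1) := by
    intro x r
    rw [← smul_eq_mul, ← map_smul, ← map_add]
    simp
  have hsep : ∀ x r, f x ≤ L0.toBar r → ∀ᵐ ω ∂μ, ω ∈ A →
      ε + (-F.comp (LinearMap.inl (L0 μ) E (L0 μ))) x ω
        - (-F.comp (LinearMap.inl (L0 μ) E (L0 μ))) x₀ ω ≤ F (0, 1) ω * (r ω - η ω) := by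
    intro x r hx
    have h1 := hF (x, r) hx
    rw [map_sub, hFapply x r, hFapply x₀ η] at h1
    filter_upwards [h1, L0.sub_apply (F (x, 0) + r * F (0, 1)) (F (x₀, 0) + η * F (0, 1)),
      L0.add_apply (F (x, 0)) (r * F (0, 1)), L0.add_apply (F (x₀, 0)) (η * F (0, 1)),
      L0.mul_apply r (F (0, 1)), L0.mul_apply η (F (0, 1)), L0.neg_apply (F (x, 0)),
      L0.neg_apply (F (x₀, 0))] with ω e1 e2 e3 e4 e5 e6 e7 e8 hω
    have h2 := e1 hω
    rw [e2, e3, e4, e5, e6] at h2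
    change ε + (-F (x, 0)) ω - (-F (x₀, 0)) ω ≤ _
    rw [e7, e8]
    linarith
  refine ⟨A, -F.comp (LinearMap.inl (L0 μ) E (L0 μ)), F (0, 1), ε, hA, hAB, hμA,
    ⟨Q, 1, hQ, zero_le_one, fun v => ?_⟩, hε, ?_, hsep⟩
  · have hq := hP.isL0Seminorm_sumSeminorm hQ
    have h1 : sumSeminorm Q (v, 0) = ∑ p ∈ Q, p v := by simp [sumSeminorm]
    have h2 := hFq (-(v, 0))
    rw [hq.map_neg, map_neg, h1] at h2
    have h3 := hFq (v, 0)
    rw [h1] at h3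
    change |-F (v, 0)| ≤ _
    rw [one_mul, abs_neg]
    exact abs_le'.2 ⟨h3, h2⟩
  · have h2 : ∀ᵐ ω ∂μ, ∀ n : ℕ, ω ∈ A →
        ε + (-F.comp (LinearMap.inl (L0 μ) E (L0 μ))) x₁ ω
        - (-F.comp (LinearMap.inl (L0 μ) E (L0 μ))) x₀ ω ≤ F (0, 1) ω * (r₁ ω + n - η ω) := by
      refine ae_all_iff.2 fun n => ?_
      have h3 : f x₁ ≤ L0.toBar (r₁ + L0.const n) := by
        rw [h₁, ← AEEqFun.coeFn_le]
        filter_upwards [L0.toBar_apply r₁, L0.toBar_apply (r₁ + L0.const n),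
          L0.add_apply r₁ (L0.const n), L0.const_apply (μ := μ) (n : ℝ)] with ω e1 e2 e3 e4
        rw [e1, e2, e3, e4, EReal.coe_le_coe_iff]
        exact le_add_of_nonneg_right (Nat.cast_nonneg n)
      filter_upwards [hsep x₁ _ h3, L0.add_apply r₁ (L0.const n),
        L0.const_apply (μ := μ) (n : ℝ)] with ω e1 e2 e3 hω
      have h4 := e1 hω
      rwa [e2, e3] at h4
    filter_upwards [h2] with ω h3 hω
    by_contra! hneg
    set c := ε + (-F.comp (LinearMap.inl (L0 μ) E (L0 μ))) x₁ ω
        - (-F.comp (LinearMap.inl (L0 μ) E (L0 μ))) x₀ ω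
    obtain ⟨n, hn⟩ := exists_nat_gt ((c - F (0, 1) ω * (r₁ ω - η ω)) / F (0, 1) ω)
    rw [div_lt_iff_of_neg hneg] at hn
    have h4 := h3 n hω
    linarith

end Minorants

/-! ### Affine minorants and the biconjugate -/

section Biconjugate

variable {Ω : Type*} [MeasurableSpace Ω] {μ : Measure Ω} {E : Type*} [AddCommGroup E]
  [Module (L0 μ) E]

/-- If `η < f(x₀)` on the non-negligible set `B`, then on a non-negligible part of `B` there is a
dominated functional `g` such that `η + g(x - x₀) ≤ r` for all `(x, r)` in the epigraph. -/
theorem exists_minorant_epi [IsProbabilityMeasure μ] {P : Set (E → L0 μ)} (hP : IsRLCModule P)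
    {f : E → L0bar μ} (hproper : IsL0Proper f) (hconvex : IsL0Convex f) (hlsc : IsEpsLamLSC P f)
    (x₀ : E) (η : L0 μ) {B : Set Ω} (hB : MeasurableSet B) (hμB : 0 < μ.real B)
    (hη : ∀ᵐ ω ∂μ, ω ∈ B → (η ω : EReal) < f x₀ ω) :
    ∃ (A : Set Ω) (g : E →ₗ[L0 μ] L0 μ), MeasurableSet A ∧ A ⊆ B ∧ 0 < μ.real A ∧
      IsSeminormDominated P g ∧
      ∀ x r, f x ≤ L0.toBar r → ∀ᵐ ω ∂μ, ω ∈ A → η ω + g x ω - g x₀ ω ≤ r ω := by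
  obtain ⟨x₁, r₁, h₁⟩ := hproper.exists_eq_toBar
  obtain ⟨A₁, g₁, β₁, ε₁, hA₁, hAB, hμA₁, hg₁, hε₁, hβ₁, hs₁⟩ :=
    exists_separation hP hproper hconvex hlsc x₀ η hB hμB hη
  -- Testing this second separation at `(x₁, r₁)` itself gives `ε₂ ≤ β₂` on `A₂`, whereas `β₁` may
  -- vanish.
  obtain ⟨A₂, g₂, β₂, ε₂, hA₂, hAA, hμA₂, hg₂, hε₂, hβ₂, hs₂⟩ :=
    exists_separation hP hproper hconvex hlsc x₁ (r₁ - 1) hA₁ hμA₁ (by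
      rw [h₁]
      filter_upwards [L0.toBar_apply r₁, L0.sub_apply r₁ 1, L0.one_apply (μ := μ)]
        with ω e1 e2 e3 _
      rw [e1, e2, e3, EReal.coe_lt_coe_iff]
      linarith)
  -- Rewriting the second inequality around `(x₀, η)` costs the error `c`. The multiple `n` of the
  -- first is chosen so that `n ε₁ = |c|` absorbs it; then `b = n β₁ + β₂ > 0` on `A₂` can be
  -- divided out.
  let c : L0 μ := g₂ x₀ - g₂ x₁ + β₂ * (r₁ - 1 - η)
  let n : L0 μ := L0.const ε₁⁻¹ * |c|
  let b : L0 μ := n * β₁ + β₂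
  refine ⟨A₂, b.inv • (n • g₁ + g₂), hA₂, hAA.trans hAB, hμA₂,
    ((hg₁.smul n).add hP hg₂).smul b.inv, fun x r hx => ?_⟩
  have hc : ∀ᵐ ω ∂μ, c ω = g₂ x₀ ω - g₂ x₁ ω + β₂ ω * (r₁ ω - 1 - η ω) := by
    filter_upwards [L0.add_apply (g₂ x₀ - g₂ x₁) (β₂ * (r₁ - 1 - η)),
      L0.sub_apply (g₂ x₀) (g₂ x₁), L0.mul_apply β₂ (r₁ - 1 - η), L0.sub_apply (r₁ - 1) η,
      L0.sub_apply r₁ 1, L0.one_apply (μ := μ)] with ω e1 e2 e3 e4 e5 e6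
    rw [e1, e2, e3, e4, e5, e6]
  have hn : ∀ᵐ ω ∂μ, n ω = ε₁⁻¹ * |c ω| := by
    filter_upwards [L0.mul_apply (L0.const ε₁⁻¹) |c|, L0.const_apply (μ := μ) ε₁⁻¹,
      L0.abs_apply c] with ω e1 e2 e3
    rw [e1, e2, e3]
  have hb : ∀ᵐ ω ∂μ, b ω = n ω * β₁ ω + β₂ ω := by
    filter_upwards [L0.add_apply (n * β₁) β₂, L0.mul_apply n β₁] with ω e1 e2
    rw [e1, e2]
  have hg : ∀ y, ∀ᵐ ω ∂μ, (b.inv • (n • g₁ + g₂)) y ω = (b ω)⁻¹ * (n ω * g₁ y ω + g₂ y ω) := by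
    intro y
    filter_upwards [L0.mul_apply b.inv (n * g₁ y + g₂ y), L0.inv_apply b,
      L0.add_apply (n * g₁ y) (g₂ y), L0.mul_apply n (g₁ y)] with ω e1 e2 e3 e4
    rw [← e4, ← e3, ← e2, ← e1]
    rfl
  filter_upwards [hc, hn, hb, hg x, hg x₀, hs₁ x r hx, hs₂ x r hx, hs₂ x₁ r₁ h₁.le, hβ₁,
    L0.sub_apply r₁ 1, L0.one_apply (μ := μ)]
    with ω hc hn hb e1 e2 e3 e4 e5 e6 e7 e8 hω
  have k1 := e3 (hAA hω)
  have k2 := e4 hω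
  have k3 := e5 hω
  rw [e7, e8] at k2 k3
  have k4 := e6 (hAA hω)
  have k5 : 0 ≤ n ω := by rw [hn]; positivity
  have k6 : 0 < b ω := by
    have := mul_nonneg k5 k4
    rw [hb]
    linarith
  have k7 : n ω * ε₁ = |c ω| := by
    rw [hn]
    field_simp
  have k8 := mul_le_mul_of_nonneg_left k1 k5
  have k9 := neg_abs_le (c ω)
  have k10 : n ω * g₁ x ω + g₂ x ω - (n ω * g₁ x₀ ω + g₂ x₀ ω) ≤ b ω * (r ω - η ω) := by
    rw [hb]
    linarith
  have k11 : (b ω)⁻¹ * (n ω * g₁ x ω + g₂ x ω - (n ω * g₁ x₀ ω + g₂ x₀ ω)) ≤ r ω - η ω :=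
    (inv_mul_le_iff₀ k6).2 k10
  rw [e1, e2]
  linarith

/-- The version of `exists_minorant_epi` for the function itself. -/
theorem exists_minorant [IsProbabilityMeasure μ] {P : Set (E → L0 μ)} (hP : IsRLCModule P)
    {f : E → L0bar μ} (hproper : IsL0Proper f) (hconvex : IsL0Convex f) (hlsc : IsEpsLamLSC P f)
    (x₀ : E) (η : L0 μ) {B : Set Ω} (hB : MeasurableSet B) (hμB : 0 < μ.real B)
    (hη : ∀ᵐ ω ∂μ, ω ∈ B → (η ω : EReal) < f x₀ ω) :
    ∃ (A : Set Ω) (g : E →ₗ[L0 μ] L0 μ), MeasurableSet A ∧ A ⊆ B ∧ 0 < μ.real A ∧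
      IsSeminormDominated P g ∧
      ∀ x, ∀ᵐ ω ∂μ, ω ∈ A → ((η ω + g x ω - g x₀ ω : ℝ) : EReal) ≤ f x ω := by
  obtain ⟨A, g, hA, hAB, hμA, hg, h⟩ :=
    exists_minorant_epi hP hproper hconvex hlsc x₀ η hB hμB hη
  obtain ⟨x₁, r₁, h₁⟩ := hproper.exists_eq_toBar
  refine ⟨A, g, hA, hAB, hμA, hg, fun x => ?_⟩
  have hm : MeasurableSet {ω | f x ω < ⊤} := measurableSet_lt (f x).measurable measurable_const
  let r₀ : L0 μ := AEEqFun.compMeasurable EReal.toReal measurable_ereal_toReal (f x)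
  have hr₀ : ∀ᵐ ω ∂μ, f x ω < ⊤ → (r₀ ω : EReal) = f x ω := by
    filter_upwards [AEEqFun.coeFn_compMeasurable EReal.toReal measurable_ereal_toReal (f x),
      hproper.2 x] with ω e1 e2 hω
    rw [e1]
    exact EReal.coe_toReal hω.ne e2.ne'
  -- Where `f x = ⊤` there is no finite height over `x`, so `x` is replaced there by `x₁`; the
  -- desired bound is trivial on that part.
  have hepi : f (L0.glue (μ := μ) hm x x₁) ≤ L0.toBar (L0.glue (μ := μ) hm r₀ r₁) := by
    rw [← AEEqFun.coeFn_le]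
    have h₁' := L0.toBar_apply r₁
    rw [← h₁] at h₁'
    filter_upwards [hconvex.apply_glue hm x x₁, L0.toBar_apply (L0.glue (μ := μ) hm r₀ r₁),
      L0.glue_apply hm r₀ r₁, hr₀, h₁'] with ω e1 e2 e3 e4 e5
    rw [e2]
    by_cases hω : f x ω < ⊤
    · rw [e3.1 hω, e4 hω]
      exact e1.1 hω
    · rw [e3.2 hω, ← e5]
      exact e1.2 hω
  filter_upwards [h _ _ hepi, L0.glue_apply hm r₀ r₁, hr₀, L0.map_glue hm g x x₁]
    with ω e1 e2 e3 e4 hω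
  by_cases hlt : f x ω < ⊤
  · have k := e1 hω
    rw [e2.1 hlt, e4.1 hlt] at k
    rw [← e3 hlt, EReal.coe_le_coe_iff]
    exact k
  · rw [not_lt_top_iff.1 hlt]
    exact le_top

theorem epsLamBiconj_le [IsProbabilityMeasure μ] {P : Set (E → L0 μ)} {f : E → L0bar μ}
    (hbot : ∀ x, ∀ᵐ ω ∂μ, ⊥ < f x ω) (x : E) : epsLamBiconj P f x ≤ f x := by
  refine (L0bar.isLUB_sup _).2 ?_
  rintro _ ⟨g, rfl⟩
  have h1 : (g.1 x).subBar (f x) ≤ epsLamConj P f g := (L0bar.isLUB_sup _).1 ⟨x, rfl⟩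
  rw [← AEEqFun.coeFn_le] at h1 ⊢
  filter_upwards [h1, L0.subBar_apply (g.1 x) (f x), L0.subBar_apply (g.1 x) (epsLamConj P f g),
    hbot x] with ω e1 e2 e3 e4
  rw [e2] at e1
  rw [e3]
  generalize f x ω = a at *
  generalize epsLamConj P f g ω = b at *
  induction a with
  | bot => exact (lt_irrefl _ e4).elim
  | top => exact le_top
  | coe a =>
    induction b with
    | bot => exact absurd e1 (EReal.bot_lt_coe (g.1 x ω - a)).not_ge
    | top => simp
    | coe b =>
      rw [← EReal.coe_sub, EReal.coe_le_coe_iff] at *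
      linarith

/-- An affine minorant `η + g(x - x₀)` of `f` on `A` bounds `f**(x₀)` from below by `η` on `A`. -/
theorem le_epsLamBiconj [IsProbabilityMeasure μ] {P : Set (E → L0 μ)} {f : E → L0bar μ}
    (g : EpsLamDual P) (x₀ : E) (η : L0 μ) {A : Set Ω} (hA : MeasurableSet A)
    (h : ∀ x, ∀ᵐ ω ∂μ, ω ∈ A → ((η ω + g.1 x ω - g.1 x₀ ω : ℝ) : EReal) ≤ f x ω) :
    ∀ᵐ ω ∂μ, ω ∈ A → (η ω : EReal) ≤ epsLamBiconj P f x₀ ω := by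
  classical
  have hm : Measurable (A.piecewise (fun ω => ((g.1 x₀ ω - η ω : ℝ) : EReal)) fun _ => ⊤) :=
    Measurable.piecewise hA (measurable_coe_real_ereal.comp
      ((g.1 x₀).measurable.sub η.measurable)) measurable_const
  -- The minorant is known only on `A`, so the upper bound for the conjugate is `⊤` elsewhere.
  let c : L0bar μ := AEEqFun.mk _ hm.aestronglyMeasurable
  have hc : ∀ᵐ ω ∂μ, (ω ∈ A → c ω = ((g.1 x₀ ω - η ω : ℝ) : EReal)) ∧ (ω ∉ A → c ω = ⊤) := by
    filter_upwards [AEEqFun.coeFn_mk _ (hm.aestronglyMeasurable (μ := μ))] with ω e1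
    exact ⟨fun hω => e1.trans (Set.piecewise_eq_of_mem _ _ _ hω),
      fun hω => e1.trans (Set.piecewise_eq_of_notMem _ _ _ hω)⟩
  have h1 : epsLamConj P f g ≤ c := by
    refine (L0bar.isLUB_sup _).2 ?_
    rintro _ ⟨x, rfl⟩
    rw [← AEEqFun.coeFn_le]
    filter_upwards [h x, hc, L0.subBar_apply (g.1 x) (f x)] with ω e1 e2 e3
    by_cases hω : ω ∈ A
    · rw [e2.1 hω, e3]
      have k := e1 hω
      generalize f x ω = a at *
      induction a with
      | bot => exact absurd k (EReal.bot_lt_coe _).not_ge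
      | top => simp
      | coe a =>
        rw [← EReal.coe_sub, EReal.coe_le_coe_iff] at *
        linarith
    · rw [e2.2 hω]
      exact le_top
  have h2 : (g.1 x₀).subBar (epsLamConj P f g) ≤ epsLamBiconj P f x₀ :=
    (L0bar.isLUB_sup _).1 ⟨g, rfl⟩
  filter_upwards [AEEqFun.coeFn_le.2 h1, AEEqFun.coeFn_le.2 h2, hc,
    L0.subBar_apply (g.1 x₀) (epsLamConj P f g)] with ω e1 e2 e3 e4 hω
  rw [e3.1 hω] at e1
  refine le_trans ?_ e2
  rw [e4]
  generalize epsLamConj P f g ω = b at *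
  induction b with
  | bot => simp
  | top => exact absurd e1 (EReal.coe_lt_top _).not_ge
  | coe b =>
    rw [← EReal.coe_sub, EReal.coe_le_coe_iff] at *
    linarith

end Biconjugate

end

theorem theorem4p5 {Ω : Type*} [MeasurableSpace Ω] (μ : Measure Ω) [IsProbabilityMeasure μ]
    {E : Type*} [AddCommGroup E] [Module (L0 μ) E] (P : Set (E → L0 μ)) (hP : IsRLCModule P)
    (f : E → L0bar μ) (hproper : IsL0Proper f) (hconvex : IsL0Convex f)
    (hlsc : IsEpsLamLSC P f) :
    epsLamBiconj P f = f := by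
  funext x₀
  refine le_antisymm (epsLamBiconj_le hproper.2 x₀) ?_
  rw [← AEEqFun.coeFn_le]
  -- Rational levels reduce the almost sure inequality to countably many null sets.
  have key : ∀ q : ℚ, ∀ᵐ ω ∂μ,
      ¬ (epsLamBiconj P f x₀ ω < ((q : ℝ) : EReal) ∧ ((q : ℝ) : EReal) < f x₀ ω) := by
    intro q
    set B : Set Ω := {ω | epsLamBiconj P f x₀ ω < ((q : ℝ) : EReal) ∧ ((q : ℝ) : EReal) < f x₀ ω}
      with hBdef
    have hB : MeasurableSet B :=
      (measurableSet_lt (epsLamBiconj P f x₀).measurable measurable_const).inter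
        (measurableSet_lt measurable_const (f x₀).measurable)
    by_contra hne
    have hμB : 0 < μ.real B := by
      refine measureReal_nonneg.lt_of_ne fun h0 => hne ?_
      exact measure_eq_zero_iff_ae_notMem.1 ((measureReal_eq_zero_iff).1 h0.symm)
    obtain ⟨A, g, hA, hAB, hμA, hg, h⟩ := exists_minorant hP hproper hconvex hlsc x₀
      (L0.const (q : ℝ)) hB hμB (by
        filter_upwards [L0.const_apply (μ := μ) (q : ℝ)] with ω e1 hω
        rw [e1]
        exact hω.2)
    have h1 := le_epsLamBiconj ⟨g, hg.continuous hP⟩ x₀ (L0.const (q : ℝ)) hA h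
    refine hμA.ne' ((measureReal_eq_zero_iff).2 (measure_eq_zero_iff_ae_notMem.2 ?_))
    filter_upwards [h1, L0.const_apply (μ := μ) (q : ℝ)] with ω e1 e2 hω
    have k := e1 hω
    rw [e2] at k
    exact k.not_gt (hAB hω).1
  filter_upwards [ae_all_iff.2 key] with ω h
  by_contra! hlt
  obtain ⟨q, hq⟩ := EReal.exists_rat_btwn_of_lt hlt
  exact h q hq
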